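/- Let $K$ be a field, let $S=K[x_1,\dots,x_n]$ with the standard grading, and let $M\subseteq S$ be a monomial ideal with minimal monomial generating set $G$. Suppose that $M$ is quadratic and dominant, that is, every $m\in G$ has degree $2$, and for every $m\in G$ there is a variable $x$ whose exponent in $m$ is strictly larger than its exponent in every $m'\in G\setminus\{m\}$. Let $k$ be the number of variables among $x_1,\dots,x_n$ that divide more than one element of $G$. Let $e(S/M)$ be the multiplicity of $S/M$ (that is, $(\deg P)!$ times the leading coefficient of the Hilbert polynomial $P$ of $S/M$ if $P\neq 0$, and $\dim_K S/M$ if $P=0$), let $\operatorname{codim}(S/M)$ be the height of $M$, and let $\operatorname{reg}(S/M)=\max\{s:\beta_{i,i+s}(S/M)\neq 0\text{ for some } i\}$ be the Castelnuovo--Mumford regularity, where $\beta_{i,j}(S/M)$ are the graded Betti numbers of $S/M$ over $S$. Then $$e(S/M)=2^{\operatorname{reg}(S/M)-k}=2^{\operatorname{codim}(S/M)-k}.$$ Equivalently, $\operatorname{reg}(S/M)=\operatorname{codim}(S/M)=k+\log_2 e(S/M)$. -/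

import Mathlib

open MvPolynomial Filter

namespace DominantIdeals

noncomputable section

/-! Throughout, `S = MvPolynomial (Fin n) K` is the polynomial ring in `n` variables over a field
`K`, and a monomial of `S` is represented by its exponent vector `m : Fin n →₀ ℕ`. -/

/-- `M` is a monomial ideal and `G` is its minimal generating set of monomials: the monomials in
`G` generate `M`, and no monomial of `G` lies in the ideal generated by the other ones. -/
structure IsMinimalMonomialGenSet {K : Type*} [Field K] {n : ℕ}
    (M : Ideal (MvPolynomial (Fin n) K)) (G : Finset (Fin n →₀ ℕ)) : Prop where
  span_eq : M = Ideal.span ((fun m => monomial m (1 : K)) '' (G : Set (Fin n →₀ ℕ)))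
  notMem_span : ∀ m ∈ G,
    monomial m (1 : K) ∉
      Ideal.span ((fun m' => monomial m' (1 : K)) '' ((G : Set (Fin n →₀ ℕ)) \ {m}))

/-- The monomial `m` is dominant in `G`: for some variable `x`, the exponent of `x` in `m` is larger
than the exponent of `x` in each other element of `G`. -/
def IsDominantIn {n : ℕ} (G : Finset (Fin n →₀ ℕ)) (m : Fin n →₀ ℕ) : Prop :=
  ∃ x : Fin n, ∀ m' ∈ G, m' ≠ m → m' x < m x

/-- `M` is a quadratic dominant (monomial) ideal with minimal generating set `G`: all elements of
`G` have degree two and are dominant in `G`. -/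
structure IsQuadraticDominant {K : Type*} [Field K] {n : ℕ}
    (M : Ideal (MvPolynomial (Fin n) K)) (G : Finset (Fin n →₀ ℕ)) : Prop where
  isMinimalMonomialGenSet : IsMinimalMonomialGenSet M G
  degree_eq_two : ∀ m ∈ G, m.degree = 2
  dominant : ∀ m ∈ G, IsDominantIn G m

/-- The number of variables that divide more than one element of `G`. -/
def numSharedVars {n : ℕ} (G : Finset (Fin n →₀ ℕ)) : ℕ :=
  (Finset.univ.filter fun x : Fin n => 1 < (G.filter fun m => m x ≠ 0).card).card

/-- The codimension of `S ⧸ M`, that is, the height of `M`. -/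
def codim {K : Type*} [Field K] {n : ℕ} (M : Ideal (MvPolynomial (Fin n) K)) : ℕ∞ :=
  M.height

/-- The degree `d` component of `S ⧸ M` (for a homogeneous ideal `M`): the image in `S ⧸ M` of the
space of homogeneous polynomials of degree `d`. -/
def quotComponent {K : Type*} [Field K] {n : ℕ} (M : Ideal (MvPolynomial (Fin n) K)) (d : ℕ) :
    Submodule K (MvPolynomial (Fin n) K ⧸ M) :=
  (homogeneousSubmodule (Fin n) K d).map (Ideal.Quotient.mkₐ K M).toLinearMap

/-- The Hilbert function `d ↦ dim_K (S ⧸ M)_d`. -/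
def hilbertFunction {K : Type*} [Field K] {n : ℕ} (M : Ideal (MvPolynomial (Fin n) K)) (d : ℕ) :
    ℕ :=
  Module.finrank K (quotComponent M d)

/-- `P` is the Hilbert polynomial of `S ⧸ M`. It is unique if it exists, and it exists for every
homogeneous `M`. -/
def IsHilbertPolynomial {K : Type*} [Field K] {n : ℕ} (M : Ideal (MvPolynomial (Fin n) K))
    (P : Polynomial ℚ) : Prop :=
  ∀ᶠ d : ℕ in atTop, (hilbertFunction M d : ℚ) = P.eval (d : ℚ)

open Classical in
/-- The multiplicity `e(S ⧸ M)` for a homogeneous ideal `M`. If the Hilbert polynomial `P` is not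
zero, this is `(deg P)!` times the leading coefficient of `P`; if `P = 0` (so that `S ⧸ M` has
Krull dimension at most `0`), this is the length of `S ⧸ M`, which is its dimension over `K`. -/
def multiplicity {K : Type*} [Field K] {n : ℕ} (M : Ideal (MvPolynomial (Fin n) K)) : ℚ :=
  if h : ∃ P : Polynomial ℚ, IsHilbertPolynomial M P then
    if h.choose = 0 then (Module.finrank K (MvPolynomial (Fin n) K ⧸ M) : ℚ)
    else (h.choose.natDegree.factorial : ℚ) * h.choose.leadingCoeff
  else 0

/-- A minimal graded free resolution
`⋯ → F 2 → F 1 → F 0 → S ⧸ M → 0`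
of `S ⧸ M`, where `F i` is the free module on the finite set `ι i`, the basis element `a : ι i`
has degree `deg i a`, the differential `F (i + 1) → F i` is given by the matrix `D i`, and the
basis element `a : ι 0` is sent to `aug a : S ⧸ M`. All maps preserve degrees. (The degrees
in a minimal graded free resolution of `S ⧸ M` cannot be negative, so natural numbers suffice.) -/
structure MinimalGradedFreeResolution {K : Type*} [Field K] {n : ℕ}
    (M : Ideal (MvPolynomial (Fin n) K)) where
  ι : ℕ → Type
  [fintypeι : ∀ i, Fintype (ι i)]
  deg : ∀ i, ι i → ℕ
  D : ∀ i, Matrix (ι i) (ι (i + 1)) (MvPolynomial (Fin n) K)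
  aug : ι 0 → MvPolynomial (Fin n) K ⧸ M
  /-- The entry of `D i` at `(a, b)` is homogeneous of degree `deg b - deg a` (and it is `0` if this
  number is negative). -/
  D_homogeneous : ∀ i a b, ∀ m ∈ (D i a b).support, m.degree + deg i a = deg (i + 1) b
  aug_homogeneous : ∀ a, aug a ∈ quotComponent M (deg 0 a)
  aug_surjective : Function.Surjective
    (Fintype.linearCombination (MvPolynomial (Fin n) K) aug)
  exact_aug : Function.Exact (D 0).mulVecLin
    (Fintype.linearCombination (MvPolynomial (Fin n) K) aug)
  exact_D : ∀ i, Function.Exact (D (i + 1)).mulVecLin (D i).mulVecLin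
  /-- Minimality: the image of each differential is contained in `(x₁, …, xₙ) F i`, that is,
  all the entries of the matrices have constant term zero. -/
  minimal : ∀ i a b, constantCoeff (D i a b) = 0

attribute [instance] MinimalGradedFreeResolution.fintypeι

/-- The number of basis elements of homological degree `i` and degree `j` in a minimal graded free
resolution. -/
def MinimalGradedFreeResolution.betti {K : Type*} [Field K] {n : ℕ}
    {M : Ideal (MvPolynomial (Fin n) K)} (F : MinimalGradedFreeResolution M) (i j : ℕ) : ℕ :=
  Nat.card {a : F.ι i // F.deg i a = j}

open Classical in
/-- The graded Betti number `β_{i,j}(S ⧸ M)` for a homogeneous ideal `M`, read off from a minimal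
graded free resolution of `S ⧸ M` (which exists and is unique up to isomorphism). -/
def gradedBetti {K : Type*} [Field K] {n : ℕ} (M : Ideal (MvPolynomial (Fin n) K)) (i j : ℕ) : ℕ :=
  if h : Nonempty (MinimalGradedFreeResolution M) then h.some.betti i j else 0

/-- The Castelnuovo–Mumford regularity `reg(S ⧸ M) = max {s : β_{i,i+s}(S ⧸ M) ≠ 0 for some i}`
for a proper homogeneous ideal `M`. -/
def regularity {K : Type*} [Field K] {n : ℕ} (M : Ideal (MvPolynomial (Fin n) K)) : ℕ :=
  sSup {s : ℕ | ∃ i : ℕ, gradedBetti M i (i + s) ≠ 0}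

end

end DominantIdeals

/-! Choosing a dominant variable `d i` in each generator writes the generators as `x_{d i} x_{o i}`.
Dominance makes `d` injective and forces `d i = o i` whenever `d i` equals some `o j`: a second
generator containing `x_{d i}` leaves only the exponent 2 in the `i`-th one. So the generators are
the edges of disjoint stars with centers `o i`, possibly with a loop at a center
(`exists_isStarFamily`). Let `c` be the number of centers.

Regularity: the lcm of a set `A` of generators has degree `|A| + |o(A)|`. It grows strictly with
`A`, so the Taylor resolution is minimal and `β_{i,i+s} ≠ 0` exactly when some `A` has `|A| = i` and
`|o(A)| = s`; the largest `s` is `c`. As `gradedBetti` reads off an arbitrary minimal resolution,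
uniqueness of Betti numbers is proved as well.

Codimension: the centers generate a prime of height `c` containing `M`, and every prime over `M`
contains `c` distinct variables, one from each star.

Multiplicity: sort the standard monomials by the set `T` of centers dividing them. Each is `x_T`
times an arbitrary monomial in `n - c + |T| - #{i : o i ∈ T}` free variables
(`IsStarFamily.standard_iff`, `IsStarFamily.card_freeVars`). This number is at most `n - c`, with
equality iff every center in `T` has just one edge. Hence `e = 2^s`, where `s` counts the one-edge
centers. The other centers are exactly the shared variables, so `k + s = c`. -/

namespace DominantIdeals

noncomputable section

/-! ### Homogeneous matrices and uniqueness of graded Betti numbers -/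

section Graded

variable {K : Type*} [Field K] {n : ℕ}

/-- The part of a polynomial in degree `b - a`; it is zero if `b < a`. -/
def shiftedComponent (a b : ℕ) : MvPolynomial (Fin n) K →ₗ[K] MvPolynomial (Fin n) K :=
  if a ≤ b then homogeneousComponent (b - a) else 0

lemma coeff_shiftedComponent (a b : ℕ) (f : MvPolynomial (Fin n) K) (m : Fin n →₀ ℕ) :
    coeff m (shiftedComponent a b f) = if m.degree + a = b then coeff m f else 0 := by
  unfold shiftedComponent
  split_ifs with h1 h2 h2
  · rw [coeff_homogeneousComponent, if_pos (by omega)]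
  · rw [coeff_homogeneousComponent, if_neg (by omega)]
  · omega
  · simp

/-- Multiplying by a homogeneous polynomial only shifts degrees. Consequently any solution of a
homogeneous linear system may be truncated to a homogeneous one. -/
lemma mul_shiftedComponent {a b c : ℕ} {p : MvPolynomial (Fin n) K}
    (hp : ∀ m ∈ p.support, m.degree + a = c) (f : MvPolynomial (Fin n) K) :
    p * shiftedComponent c b f = shiftedComponent a b (p * f) := by
  classical
  ext m
  rw [coeff_shiftedComponent, coeff_mul, coeff_mul]
  have ite_sum : ∀ (p : Prop) [Decidable p] (s : Finset ((Fin n →₀ ℕ) × (Fin n →₀ ℕ)))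
      (g : (Fin n →₀ ℕ) × (Fin n →₀ ℕ) → K),
      (if p then ∑ x ∈ s, g x else 0) = ∑ x ∈ s, if p then g x else 0 := by
    intro p _ s g
    split_ifs <;> simp
  rw [ite_sum]
  refine Finset.sum_congr rfl fun x hx => ?_
  rw [coeff_shiftedComponent]
  rw [Finset.HasAntidiagonal.mem_antidiagonal] at hx
  by_cases h : coeff x.1 p = 0
  · simp [h]
  · have h1 := hp x.1 (mem_support_iff.2 h)
    have h2 : m.degree = x.1.degree + x.2.degree := by rw [← hx, map_add]
    by_cases h3 : x.2.degree + c = b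
    · rw [if_pos h3, if_pos (by omega)]
    · rw [if_neg h3, if_neg (by omega), mul_zero]

lemma shiftedComponent_eq_self {a b : ℕ} {p : MvPolynomial (Fin n) K}
    (hp : ∀ m ∈ p.support, m.degree + a = b) : shiftedComponent a b p = p := by
  ext m
  rw [coeff_shiftedComponent]
  split_ifs with h
  · rfl
  · by_contra h0
    exact h (hp m (mem_support_iff.2 fun h1 => h0 h1.symm))

lemma degree_of_mem_support_shiftedComponent {a b : ℕ} {p : MvPolynomial (Fin n) K}
    {m : Fin n →₀ ℕ} (hm : m ∈ (shiftedComponent a b p).support) : m.degree + a = b := by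
  by_contra h
  rw [mem_support_iff, coeff_shiftedComponent, if_neg h] at hm
  exact hm rfl

/-- The entry at `(a, b)` of the matrix `X` is homogeneous of degree `db b - da a`. -/
def IsHomogeneousMatrix {α β : Type*} (da : α → ℕ) (db : β → ℕ)
    (X : Matrix α β (MvPolynomial (Fin n) K)) : Prop :=
  ∀ a b, ∀ m ∈ (X a b).support, m.degree + da a = db b

lemma IsHomogeneousMatrix.mul {α β γ : Type*} [Fintype β] {da : α → ℕ} {db : β → ℕ}
    {dc : γ → ℕ} {X : Matrix α β (MvPolynomial (Fin n) K)}
    {Y : Matrix β γ (MvPolynomial (Fin n) K)} (hX : IsHomogeneousMatrix da db X)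
    (hY : IsHomogeneousMatrix db dc Y) : IsHomogeneousMatrix da dc (X * Y) := by
  have h : X * Y = fun a c => shiftedComponent (da a) (dc c) ((X * Y) a c) := by
    ext1 a c
    simp only [Matrix.mul_apply, map_sum]
    refine Finset.sum_congr rfl fun b _ => ?_
    rw [← mul_shiftedComponent (hX a b), shiftedComponent_eq_self (hY b c)]
  intro a c m hm
  rw [h] at hm
  exact degree_of_mem_support_shiftedComponent hm

/-- Each column of `X` is lifted through `D` and then truncated to the right degree; the truncation
still solves the equation because `D` and `X` are homogeneous. -/
lemma exists_isHomogeneousMatrix_mul_eq {α β γ : Type*} [Fintype β] [Fintype γ]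
    [DecidableEq β] {da : α → ℕ} {db : β → ℕ} {dc : γ → ℕ}
    {D : Matrix α γ (MvPolynomial (Fin n) K)} {X : Matrix α β (MvPolynomial (Fin n) K)}
    (hD : IsHomogeneousMatrix da dc D) (hX : IsHomogeneousMatrix da db X)
    (h : ∀ v, X.mulVec v ∈ Set.range D.mulVecLin) :
    ∃ Y : Matrix γ β (MvPolynomial (Fin n) K), IsHomogeneousMatrix dc db Y ∧ D * Y = X := by
  choose w hw using fun b : β => h (Pi.single b 1)
  refine ⟨Matrix.of fun c b => shiftedComponent (dc c) (db b) (w b c),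
    fun c b m hm => degree_of_mem_support_shiftedComponent hm, ?_⟩
  ext1 a b
  have h1 : ∑ c, D a c * w b c = X a b := by
    have := congrFun (hw b) a
    rw [Matrix.mulVec_single_one] at this
    simpa [Matrix.mulVec, dotProduct] using this
  simp only [Matrix.mul_apply, Matrix.of_apply]
  rw [Finset.sum_congr rfl fun c _ => mul_shiftedComponent (hD a c) (w b c), ← map_sum, h1,
    shiftedComponent_eq_self (hX a b)]

/-- The same lifting at the augmentation. Here the equation holds only modulo `M`, and `hM` allows
the congruence to be truncated. -/
lemma exists_isHomogeneousMatrix_aug {M : Ideal (MvPolynomial (Fin n) K)}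
    (hM : ∀ f ∈ M, ∀ j, homogeneousComponent j f ∈ M) {β γ : Type*} [Fintype γ]
    {db : β → ℕ} {dc : γ → ℕ} {e : γ → MvPolynomial (Fin n) K ⧸ M}
    {e' : β → MvPolynomial (Fin n) K ⧸ M}
    (he : ∀ c, e c ∈ quotComponent M (dc c)) (he' : ∀ b, e' b ∈ quotComponent M (db b))
    (hs : Function.Surjective (Fintype.linearCombination (MvPolynomial (Fin n) K) e)) :
    ∃ Y : Matrix γ β (MvPolynomial (Fin n) K), IsHomogeneousMatrix dc db Y ∧
      ∀ b, ∑ c, Y c b • e c = e' b := by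
  choose p hp hpe using he
  choose q hq hqe using he'
  choose w hw using fun b => hs (e' b)
  refine ⟨Matrix.of fun c b => shiftedComponent (dc c) (db b) (w b c),
    fun c b m hm => degree_of_mem_support_shiftedComponent hm, fun b => ?_⟩
  have hpe' : ∀ c, e c = Ideal.Quotient.mk M (p c) := fun c => (hpe c).symm
  have hqe' : ∀ b, e' b = Ideal.Quotient.mk M (q b) := fun c => (hqe c).symm
  have key : ∀ v : γ → MvPolynomial (Fin n) K,
      ∑ c, v c • e c = Ideal.Quotient.mk M (∑ c, p c * v c) := by
    intro v
    rw [map_sum]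
    refine Finset.sum_congr rfl fun c _ => ?_
    rw [hpe', mul_comm, map_mul]
    rfl
  have h1 : ∑ c, w b c • e c = e' b := hw b
  rw [key, hqe', Ideal.Quotient.mk_eq_mk_iff_sub_mem] at h1 ⊢
  have hdeg : ∀ (f : MvPolynomial (Fin n) K) (j : ℕ), f ∈ homogeneousSubmodule (Fin n) K j →
      ∀ m ∈ f.support, m.degree + 0 = j := by
    intro f j hf m hm
    rw [add_zero, Finsupp.degree_eq_weight_one]
    exact hf (mem_support_iff.1 hm)
  simp only [Matrix.of_apply]
  rw [Finset.sum_congr rfl fun c _ => mul_shiftedComponent (hdeg _ _ (hp c)) (w b c), ← map_sum,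
    ← shiftedComponent_eq_self (hdeg _ _ (hq b)), ← map_sub]
  simpa [shiftedComponent] using hM _ h1 (db b)

/-- Serves to build chain maps and homotopies degree by degree; `P` is the invariant that makes the
next lift possible. -/
lemma exists_seq_of_step {X : ℕ → Type*} (P : ∀ i, X i → Prop) (r : ∀ i, X i → X (i + 1) → Prop)
    {x₀ : X 0} (h0 : P 0 x₀) (hs : ∀ i x, P i x → ∃ y, P (i + 1) y ∧ r i x y) :
    ∃ x : ∀ i, X i, x 0 = x₀ ∧ (∀ i, P i (x i)) ∧ ∀ i, r i (x i) (x (i + 1)) := by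
  let x : ∀ i, {x : X i // P i x} := fun i =>
    Nat.rec ⟨x₀, h0⟩ (fun i x => ⟨(hs i x.1 x.2).choose, (hs i x.1 x.2).choose_spec.1⟩) i
  exact ⟨fun i => (x i).1, rfl, fun i => (x i).2,
    fun i => (hs i (x i).1 (x i).2).choose_spec.2⟩

namespace MinimalGradedFreeResolution

variable {M : Ideal (MvPolynomial (Fin n) K)}

lemma linearCombination_mulVec {β γ : Type*} [Fintype β] [Fintype γ]
    (Y : Matrix γ β (MvPolynomial (Fin n) K)) (e : γ → MvPolynomial (Fin n) K ⧸ M)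
    (v : β → MvPolynomial (Fin n) K) :
    Fintype.linearCombination (MvPolynomial (Fin n) K) e (Y.mulVec v) =
      Fintype.linearCombination (MvPolynomial (Fin n) K) (fun b => ∑ c, Y c b • e c) v := by
  simp only [Fintype.linearCombination_apply, Matrix.mulVec, dotProduct, Finset.sum_smul,
    Finset.smul_sum]
  rw [Finset.sum_comm]
  refine Finset.sum_congr rfl fun b _ => Finset.sum_congr rfl fun c _ => ?_
  rw [smul_smul, mul_comm]

lemma D_mulVec_D (F : MinimalGradedFreeResolution M) (i : ℕ)
    (v : F.ι (i + 2) → MvPolynomial (Fin n) K) :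
    (F.D i).mulVec ((F.D (i + 1)).mulVec v) = 0 :=
  (F.exact_D i).apply_apply_eq_zero v

/-- Any two minimal graded free resolutions are compared by a homogeneous chain map. -/
theorem exists_comparison (hM : ∀ f ∈ M, ∀ j, homogeneousComponent j f ∈ M)
    (F F' : MinimalGradedFreeResolution M) :
    ∃ φ : ∀ i, Matrix (F'.ι i) (F.ι i) (MvPolynomial (Fin n) K),
      (∀ i, IsHomogeneousMatrix (F'.deg i) (F.deg i) (φ i)) ∧
      (∀ b, ∑ c, φ 0 c b • F'.aug c = F.aug b) ∧
      ∀ i, F'.D i * φ (i + 1) = φ i * F.D i := by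
  classical
  obtain ⟨φ₀, hφ₀, hφ₀'⟩ := exists_isHomogeneousMatrix_aug hM F'.aug_homogeneous
    F.aug_homogeneous F'.aug_surjective
  -- The invariant says that `φ * F.D i` lands in the image of `F'.D i`, which is what the next lift
  -- needs.
  obtain ⟨φ, h0, hP, hr⟩ := exists_seq_of_step
    (X := fun i => Matrix (F'.ι i) (F.ι i) (MvPolynomial (Fin n) K))
    (fun i φ => IsHomogeneousMatrix (F'.deg i) (F.deg i) φ ∧
      ∀ v, (φ * F.D i).mulVec v ∈ Set.range (F'.D i).mulVecLin)
    (fun i φ ψ => F'.D i * ψ = φ * F.D i) (x₀ := φ₀)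
    ⟨hφ₀, fun v => by
      refine (F'.exact_aug _).1 ?_
      rw [← Matrix.mulVec_mulVec, linearCombination_mulVec, funext hφ₀']
      exact F.exact_aug.apply_apply_eq_zero v⟩
    (fun i φ hφ => by
      obtain ⟨ψ, hψ, hψ'⟩ :=
        exists_isHomogeneousMatrix_mul_eq (F'.D_homogeneous i) (hφ.1.mul (F.D_homogeneous i)) hφ.2
      refine ⟨ψ, ⟨hψ, fun v => (F'.exact_D i _).1 ?_⟩, hψ'⟩
      rw [Matrix.mulVecLin_apply, Matrix.mulVec_mulVec, ← Matrix.mul_assoc, hψ',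
        ← Matrix.mulVec_mulVec, ← Matrix.mulVec_mulVec, D_mulVec_D, Matrix.mulVec_zero])
  exact ⟨φ, fun i => (hP i).1, fun b => by rw [h0]; exact hφ₀' b, hr⟩

/-- A chain endomorphism over the zero map vanishes modulo the variables. -/
theorem constantCoeff_eq_zero_of_aug_eq_zero (F : MinimalGradedFreeResolution M)
    (χ : ∀ i, Matrix (F.ι i) (F.ι i) (MvPolynomial (Fin n) K))
    (h0 : ∀ b, ∑ c, χ 0 c b • F.aug c = 0)
    (hχ : ∀ i, F.D i * χ (i + 1) = χ i * F.D i) (i : ℕ) (a b : F.ι i) :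
    constantCoeff (χ i a b) = 0 := by
  classical
  have lift : ∀ (i : ℕ) (X : Matrix (F.ι i) (F.ι i) (MvPolynomial (Fin n) K)),
      (∀ v, X.mulVec v ∈ Set.range (F.D i).mulVecLin) →
      ∃ Y : Matrix (F.ι (i + 1)) (F.ι i) (MvPolynomial (Fin n) K), F.D i * Y = X := by
    intro i X hX
    choose w hw using fun b => hX (Pi.single b 1)
    refine ⟨Matrix.of fun c b => w b c, ?_⟩
    ext1 a b
    have := congrFun (hw b) a
    rw [Matrix.mulVec_single_one] at this
    simpa [Matrix.mulVec, dotProduct, Matrix.mul_apply] using this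
  obtain ⟨h₀, hh₀⟩ := lift 0 (χ 0) fun v => (F.exact_aug _).1 (by
    rw [linearCombination_mulVec, funext h0]
    simp [Fintype.linearCombination_apply])
  -- The maps `h i` form a null-homotopy: `χ (i + 1) = D (i + 1) * h (i + 1) + h i * D i`. Both
  -- terms vanish modulo the variables by minimality.
  obtain ⟨h, hz, hP, hr⟩ := exists_seq_of_step
    (X := fun i => Matrix (F.ι (i + 1)) (F.ι i) (MvPolynomial (Fin n) K))
    (fun i h => ∀ v, (χ (i + 1) - h * F.D i).mulVec v ∈ Set.range (F.D (i + 1)).mulVecLin)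
    (fun i h h' => F.D (i + 1) * h' = χ (i + 1) - h * F.D i) (x₀ := h₀)
    (fun v => (F.exact_D 0 _).1 (by
      rw [Matrix.mulVecLin_apply, Matrix.mulVec_mulVec, Matrix.mul_sub, ← Matrix.mul_assoc, hh₀,
        hχ, sub_self, Matrix.zero_mulVec]))
    (fun i h hh => by
      obtain ⟨h', hh'⟩ := lift (i + 1) _ hh
      refine ⟨h', fun v => (F.exact_D (i + 1) _).1 ?_, hh'⟩
      rw [Matrix.mulVecLin_apply, Matrix.mulVec_mulVec, Matrix.mul_sub, ← Matrix.mul_assoc, hh',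
        hχ, Matrix.sub_mul, sub_sub_cancel, Matrix.mul_assoc, ← Matrix.mulVec_mulVec,
        ← Matrix.mulVec_mulVec, D_mulVec_D, Matrix.mulVec_zero])
  have hmin : ∀ (i : ℕ) {α : Type} (Y : Matrix (F.ι (i + 1)) α (MvPolynomial (Fin n) K)) (a b),
      constantCoeff ((F.D i * Y) a b) = 0 := by
    intro i α Y a b
    simp [Matrix.mul_apply, F.minimal]
  cases i with
  | zero => rw [← hh₀]; exact hmin 0 _ a b
  | succ i =>
    have h1 : χ (i + 1) = F.D (i + 1) * h (i + 1) + h i * F.D i := by rw [hr, sub_add_cancel]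
    rw [h1, Matrix.add_apply, map_add, hmin, Matrix.mul_apply]
    simp [F.minimal]

lemma sum_mul_smul_aug {α β γ : Type*} [Fintype β] [Fintype γ]
    (X : Matrix γ β (MvPolynomial (Fin n) K)) (Y : Matrix β α (MvPolynomial (Fin n) K))
    (e : γ → MvPolynomial (Fin n) K ⧸ M) (a : α) :
    ∑ c, (X * Y) c a • e c = ∑ b, Y b a • ∑ c, X c b • e c := by
  simp only [Matrix.mul_apply, Finset.sum_smul, Finset.smul_sum]
  rw [Finset.sum_comm]
  refine Finset.sum_congr rfl fun b _ => Finset.sum_congr rfl fun c _ => ?_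
  rw [smul_smul, mul_comm]

lemma card_le_card_of_mul_eq_one {α β : Type*} [Fintype α] [Fintype β] [DecidableEq α]
    (X : Matrix α β K) (Y : Matrix β α K) (h : X * Y = 1) : Fintype.card α ≤ Fintype.card β := by
  classical
  have := Matrix.rank_mul_le_right X Y
  rw [h, Matrix.rank_one] at this
  exact this.trans (Matrix.rank_le_card_height Y)

/-- For comparison maps `φ`, `ψ` in opposite directions, `ψ φ - 1` lifts zero and so vanishes modulo
the variables. Over `K` this exhibits an identity matrix factoring through the other basis. -/
lemma betti_le_betti (hM : ∀ f ∈ M, ∀ j, homogeneousComponent j f ∈ M)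
    (F F' : MinimalGradedFreeResolution M) (i j : ℕ) : F.betti i j ≤ F'.betti i j := by
  classical
  obtain ⟨φ, hφ, hφ0, hφD⟩ := exists_comparison hM F F'
  obtain ⟨ψ, hψ, hψ0, hψD⟩ := exists_comparison hM F' F
  have key := constantCoeff_eq_zero_of_aug_eq_zero F (fun i => ψ i * φ i - 1)
    (fun b => by
      simp only [Matrix.sub_apply, sub_smul, Finset.sum_sub_distrib]
      rw [sum_mul_smul_aug, Finset.sum_congr rfl fun c _ => by rw [hψ0 c], hφ0]
      simp [Matrix.one_apply])
    (fun i => by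
      simp only [Matrix.mul_sub, Matrix.sub_mul, Matrix.mul_one, Matrix.one_mul]
      rw [← Matrix.mul_assoc, hψD, Matrix.mul_assoc, hφD, Matrix.mul_assoc]) i
  unfold betti
  rw [Nat.card_eq_fintype_card, Nat.card_eq_fintype_card]
  refine card_le_card_of_mul_eq_one
    (Matrix.of fun a c => constantCoeff (ψ i a.1 c.1))
    (Matrix.of fun c b => constantCoeff (φ i c.1 b.1)) ?_
  ext a b
  have h1 := key a.1 b.1
  rw [Matrix.sub_apply, map_sub, sub_eq_zero, Matrix.mul_apply, map_sum] at h1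
  have h2 : constantCoeff ((1 : Matrix (F.ι i) (F.ι i) (MvPolynomial (Fin n) K)) a.1 b.1) =
      (1 : Matrix {a : F.ι i // F.deg i a = j} {a : F.ι i // F.deg i a = j} K) a b := by
    simp only [Matrix.one_apply, Subtype.ext_iff]
    split_ifs <;> simp
  rw [← h2, ← h1, Matrix.mul_apply]
  -- A homogeneous entry between different degrees has no constant term, so the degree `j` blocks
  -- multiply among themselves.
  have h3 : ∀ c : F'.ι i, F'.deg i c ≠ j → constantCoeff (ψ i a.1 c) = 0 := by
    intro c hc
    by_contra h0
    have := hψ i a.1 c 0 (mem_support_iff.2 h0)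
    rw [map_zero, zero_add, a.2] at this
    exact hc this.symm
  simp only [Matrix.of_apply, map_mul]
  rw [← Finset.sum_subtype (Finset.univ.filter fun c => F'.deg i c = j) (by simp)
    (fun c => constantCoeff (ψ i a.1 c) * constantCoeff (φ i c b.1))]
  refine Finset.sum_subset (Finset.filter_subset _ _) fun c _ hc => ?_
  rw [h3 c (by simpa using hc), zero_mul]

theorem betti_eq_betti (hM : ∀ f ∈ M, ∀ j, homogeneousComponent j f ∈ M)
    (F F' : MinimalGradedFreeResolution M) (i j : ℕ) : F.betti i j = F'.betti i j :=
  le_antisymm (betti_le_betti hM F F' i j) (betti_le_betti hM F' F i j)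

theorem gradedBetti_eq (hM : ∀ f ∈ M, ∀ j, homogeneousComponent j f ∈ M)
    (F : MinimalGradedFreeResolution M) (i j : ℕ) : gradedBetti M i j = F.betti i j := by
  unfold gradedBetti
  rw [dif_pos ⟨F⟩]
  exact betti_eq_betti hM _ _ i j

end MinimalGradedFreeResolution

end Graded

/-! ### The Taylor resolution -/

section Taylor

variable {K : Type*} [Field K] {n r : ℕ}

/-- The incidence sign of `b` in `insert b A`. -/
def incidenceSign (K : Type*) [Field K] (b : Fin r) (A : Finset (Fin r)) : K :=
  (-1) ^ (A.filter (· < b)).card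

lemma incidenceSign_eq_one {b : Fin r} {A : Finset (Fin r)} (h : ∀ a ∈ A, b ≤ a) :
    incidenceSign K b A = 1 := by
  rw [incidenceSign, Finset.filter_false_of_mem fun a ha => not_lt.2 (h a ha)]
  simp

lemma incidenceSign_insert {b c : Fin r} {A : Finset (Fin r)} (hc : c ∉ A) :
    incidenceSign K b (insert c A) = if c < b then -incidenceSign K b A else
      incidenceSign K b A := by
  unfold incidenceSign
  rw [Finset.filter_insert]
  split_ifs with h
  · rw [Finset.card_insert_of_notMem fun h' => hc (Finset.mem_filter.1 h').1, pow_succ]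
    ring
  · rfl

lemma incidenceSign_mul_add {b c : Fin r} {A : Finset (Fin r)} (hb : b ∉ A) (hc : c ∉ A)
    (hbc : b ≠ c) :
    incidenceSign K b A * incidenceSign K c (insert b A) +
      incidenceSign K c A * incidenceSign K b (insert c A) = 0 := by
  rw [incidenceSign_insert hb, incidenceSign_insert hc]
  rcases lt_or_gt_of_ne hbc with h | h
  · rw [if_pos h, if_neg h.asymm]; ring
  · rw [if_neg h.asymm, if_pos h]; ring

/-- The contracting homotopy of a full simplex given by its smallest vertex. -/
lemma sum_incidenceSign_cone {S : Finset (Fin r)} {v : Fin r}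
    (hmin : ∀ j ∈ S, v ≤ j) {φ : Finset (Fin r) → K} (hφ : ∀ A, ¬A ⊆ S → φ A = 0)
    (hd : ∀ A ⊆ S, ∑ b ∈ Aᶜ, incidenceSign K b A * φ (insert b A) = 0)
    {A : Finset (Fin r)} (hA : A ⊆ S) :
    ∑ b ∈ Aᶜ, incidenceSign K b A *
      (if v ∈ insert b A then φ ((insert b A).erase v) else 0) = φ A := by
  by_cases hvA : v ∈ A
  -- For `v ∈ A`, the cycle relation at `A.erase v` expresses `φ A` through the other faces; for `v
  -- ∉ A`, only the summand `b = v` survives.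
  · have h1 := hd (A.erase v) ((Finset.erase_subset _ _).trans hA)
    rw [Finset.compl_erase, Finset.sum_insert (by simpa using hvA), Finset.insert_erase hvA,
      incidenceSign_eq_one (fun a ha => hmin a (hA (Finset.mem_of_mem_erase ha))), one_mul,
      add_eq_zero_iff_eq_neg, ← Finset.sum_neg_distrib] at h1
    rw [h1]
    refine Finset.sum_congr rfl fun b hb => ?_
    have hbA : b ∉ A := by simpa using hb
    have hvb : v ≠ b := fun h => hbA (h ▸ hvA)
    rw [if_pos (Finset.mem_insert_of_mem hvA), Finset.erase_insert_of_ne hvb.symm]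
    by_cases hbS : b ∈ S
    · have h2 := incidenceSign_insert (K := K) (b := b) (Finset.notMem_erase v A)
      rw [Finset.insert_erase hvA, if_pos (lt_of_le_of_ne (hmin b hbS) hvb)] at h2
      rw [h2, neg_mul]
    · rw [hφ (insert b (A.erase v)) fun h => hbS (h (Finset.mem_insert_self _ _))]
      simp
  · rw [Finset.sum_eq_single v]
    · rw [if_pos (Finset.mem_insert_self _ _), Finset.erase_insert hvA,
        incidenceSign_eq_one fun a ha => hmin a (hA ha), one_mul]
    · intro b _ hbv
      rw [if_neg, mul_zero]
      rw [Finset.mem_insert]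
      exact fun h => h.elim (fun h => hbv h.symm) hvA
    · intro h
      simp [hvA] at h

variable (g : Fin r → (Fin n →₀ ℕ))

/-- The differential of the Taylor complex of the monomials `g`, on all faces at once. -/
def taylorDifferential (F : Finset (Fin r) → MvPolynomial (Fin n) K) (A : Finset (Fin r)) :
    MvPolynomial (Fin n) K :=
  ∑ b ∈ Aᶜ, monomial ((insert b A).sup g - A.sup g) (incidenceSign K b A) * F (insert b A)

/-- The coefficients of `F` in multidegree `u`. -/
def strand (F : Finset (Fin r) → MvPolynomial (Fin n) K) (u : Fin n →₀ ℕ)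
    (A : Finset (Fin r)) : K :=
  open Classical in if A.sup g ≤ u then coeff (u - A.sup g) (F A) else 0

variable {g}

lemma strand_add (F : Finset (Fin r) → MvPolynomial (Fin n) K) (w : Fin n →₀ ℕ)
    (A : Finset (Fin r)) : strand g F (w + A.sup g) A = coeff w (F A) := by
  rw [strand, if_pos le_add_self, add_tsub_cancel_right]

lemma sup_le_sup_insert (b : Fin r) (A : Finset (Fin r)) : A.sup g ≤ (insert b A).sup g :=
  Finset.sup_mono (Finset.subset_insert _ _)

/-- In a fixed multidegree `u` the Taylor complex is the chain complex of the full simplex on the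
generators dividing `x^u`. -/
lemma coeff_taylorDifferential (F : Finset (Fin r) → MvPolynomial (Fin n) K) (w : Fin n →₀ ℕ)
    (A : Finset (Fin r)) :
    coeff w (taylorDifferential g F A) =
      ∑ b ∈ Aᶜ, incidenceSign K b A * strand g F (w + A.sup g) (insert b A) := by
  rw [taylorDifferential, coeff_sum]
  refine Finset.sum_congr rfl fun b _ => ?_
  have h := sup_le_sup_insert (g := g) b A
  rw [coeff_monomial_mul', strand]
  by_cases h1 : (insert b A).sup g - A.sup g ≤ w
  · rw [if_pos h1, if_pos (tsub_le_iff_right.1 h1), tsub_tsub_eq_add_tsub_of_le h]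
  · rw [if_neg h1, if_neg fun h2 => h1 (tsub_le_iff_right.2 h2), mul_zero]

lemma taylorDifferential_taylorDifferential (F : Finset (Fin r) → MvPolynomial (Fin n) K)
    (A : Finset (Fin r)) : taylorDifferential g (taylorDifferential g F) A = 0 := by
  unfold taylorDifferential
  simp only [Finset.mul_sum]
  rw [Finset.sum_sigma']
  have hmem : ∀ x : (_ : Fin r) × Fin r, x ∈ Aᶜ.sigma (fun b => (insert b A)ᶜ) ↔
      x.1 ∉ A ∧ x.2 ∉ A ∧ x.1 ≠ x.2 := by
    intro x
    simp only [Finset.mem_sigma, Finset.mem_compl, Finset.mem_insert, not_or]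
    tauto
  refine Finset.sum_involution (fun x _ => ⟨x.2, x.1⟩) ?_ ?_ ?_ ?_
  · rintro ⟨b, c⟩ hx
    obtain ⟨hb, hc, hbc⟩ := (hmem _).1 hx
    dsimp only at hb hc hbc ⊢
    have h1 := tsub_add_tsub_cancel (sup_le_sup_insert (g := g) c (insert b A))
      (sup_le_sup_insert (g := g) b A)
    have h2 := tsub_add_tsub_cancel (sup_le_sup_insert (g := g) b (insert c A))
      (sup_le_sup_insert (g := g) c A)
    rw [← mul_assoc, ← mul_assoc, monomial_mul, monomial_mul, add_comm, add_comm (_ - _) (_ - _),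
      h2, add_comm (_ - _) (_ - _), h1, Finset.insert_comm b c, ← add_mul, ← map_add,
      add_comm, incidenceSign_mul_add hb hc hbc, monomial_zero, zero_mul]
  · rintro ⟨b, c⟩ hx _ h
    obtain ⟨_, _, hbc⟩ := (hmem _).1 hx
    simp only [Sigma.mk.injEq, heq_eq_eq] at h
    exact hbc h.2
  · rintro ⟨b, c⟩ hx
    rw [hmem] at hx ⊢
    exact ⟨hx.2.1, hx.1, hx.2.2.symm⟩
  · rintro ⟨b, c⟩ _
    rfl

lemma strand_eq_zero_of_forall_not_le {F : Finset (Fin r) → MvPolynomial (Fin n) K}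
    {u : Fin n →₀ ℕ} {A : Finset (Fin r)} (hA : A.Nonempty) (h : ∀ j, ¬g j ≤ u) :
    strand g F u A = 0 := by
  obtain ⟨j, hj⟩ := hA
  rw [strand, if_neg fun h' => h j ((Finset.le_sup hj).trans h')]

/-- Exactness of the Taylor complex. -/
theorem exists_taylorDifferential_eq (F : Finset (Fin r) → MvPolynomial (Fin n) K)
    (h0 : ∀ u, (∀ j, ¬g j ≤ u) → ∀ A, strand g F u A = 0)
    (hD : ∀ A, taylorDifferential g F A = 0) :
    ∃ H : Finset (Fin r) → MvPolynomial (Fin n) K, (∀ A, taylorDifferential g H A = F A) ∧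
      ∀ B, (∀ v ∈ B, F (B.erase v) = 0) → H B = 0 := by
  classical
  -- The cone homotopy in multidegree `u`, with apex the smallest `v` such that `g v ≤ u`. The set
  -- `U` collects the finitely many multidegrees in which `F` lives, so that `H` consists of
  -- polynomials.
  let st : (Fin n →₀ ℕ) → Finset (Fin r) → K := fun u B =>
    ∑ v ∈ B, if g v ≤ u ∧ ∀ j, g j ≤ u → v ≤ j then strand g F u (B.erase v) else 0
  let U : Finset (Fin n →₀ ℕ) :=
    Finset.univ.biUnion fun A : Finset (Fin r) => (F A).support.image (· + A.sup g)
  let H : Finset (Fin r) → MvPolynomial (Fin n) K := fun B =>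
    ∑ u ∈ U, if B.sup g ≤ u then monomial (u - B.sup g) (st u B) else 0
  have hU : ∀ u ∉ U, ∀ A, strand g F u A = 0 := by
    intro u hu A
    unfold strand
    split_ifs with h
    · by_contra hc
      refine hu (Finset.mem_biUnion.2 ⟨A, Finset.mem_univ _,
        Finset.mem_image.2 ⟨u - A.sup g, mem_support_iff.2 hc, tsub_add_cancel_of_le h⟩⟩)
    · rfl
  have hst : ∀ u ∉ U, ∀ B, st u B = 0 := by
    intro u hu B
    refine Finset.sum_eq_zero fun v _ => ?_
    rw [hU u hu, ite_self]
  have hH : ∀ u B, B.sup g ≤ u → strand g H u B = st u B := by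
    intro u B huB
    rw [strand, if_pos huB, coeff_sum]
    by_cases hu : u ∈ U
    · rw [Finset.sum_eq_single_of_mem u hu, if_pos huB, coeff_monomial, if_pos rfl]
      intro u' _ hne
      split_ifs with h
      · rw [coeff_monomial, if_neg]
        intro he
        apply hne
        rw [← tsub_add_cancel_of_le h, he, tsub_add_cancel_of_le huB]
      · simp
    · rw [hst u hu]
      refine Finset.sum_eq_zero fun u' hu' => ?_
      split_ifs with h
      · rw [coeff_monomial, if_neg]
        intro he
        apply hu
        rw [← tsub_add_cancel_of_le huB, ← he, tsub_add_cancel_of_le h]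
        exact hu'
      · simp
  refine ⟨H, fun A => ?_, fun B hB => ?_⟩
  · ext w
    rw [coeff_taylorDifferential, ← strand_add (g := g) F w A]
    set u := w + A.sup g with hu
    have hAu : A.sup g ≤ u := le_add_self
    let S : Finset (Fin r) := Finset.univ.filter fun j => g j ≤ u
    have hS : ∀ B : Finset (Fin r), B.sup g ≤ u ↔ B ⊆ S := by
      intro B
      simp [S, Finset.sup_le_iff, Finset.subset_iff]
    by_cases hne : S.Nonempty
    · have hvS := Finset.min'_mem S hne
      have hmin : ∀ j ∈ S, S.min' hne ≤ j := fun j hj => Finset.min'_le S j hj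
      set v := S.min' hne
      have hv : g v ≤ u := by simpa [S] using hvS
      have hst' : ∀ B, st u B = if v ∈ B then strand g F u (B.erase v) else 0 := by
        intro B
        have huniq : ∀ v', (g v' ≤ u ∧ ∀ j, g j ≤ u → v' ≤ j) ↔ v' = v := by
          intro v'
          constructor
          · rintro ⟨h1, h2⟩
            exact le_antisymm (h2 v hv) (hmin v' (by simpa [S] using h1))
          · rintro rfl
            exact ⟨hv, fun j hj => hmin j (by simpa [S] using hj)⟩
        simp only [st, huniq]
        rw [Finset.sum_ite_eq']
      have hφ : ∀ A, ¬A ⊆ S → strand g F u A = 0 := by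
        intro A hA
        rw [strand, if_neg fun h => hA ((hS A).1 h)]
      rw [← sum_incidenceSign_cone hmin hφ (fun B hB => ?_) ((hS A).1 hAu)]
      · refine Finset.sum_congr rfl fun b _ => ?_
        rw [← hst']
        by_cases hb : (insert b A).sup g ≤ u
        · rw [hH u _ hb]
        · rw [hst', strand, if_neg hb]
          split_ifs with h
          · rw [hφ]
            intro h'
            apply hb
            rw [hS, ← Finset.insert_erase h]
            exact Finset.insert_subset hvS h'
          · rfl
      · have h1 := congrArg (coeff (u - B.sup g)) (hD B)
        rwa [coeff_taylorDifferential, tsub_add_cancel_of_le ((hS B).2 hB), coeff_zero] at h1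
    -- With no vertices there is no cone; this is where `h0` enters.
    · have hno : ∀ j, ¬g j ≤ u := by
        intro j hj
        exact hne ⟨j, by simpa [S] using hj⟩
      rw [h0 u hno]
      refine Finset.sum_eq_zero fun b _ => ?_
      rw [strand_eq_zero_of_forall_not_le (Finset.insert_nonempty _ _) hno, mul_zero]
  · refine Finset.sum_eq_zero fun u _ => ?_
    have : st u B = 0 := by
      refine Finset.sum_eq_zero fun v hv => ?_
      simp [strand, hB v hv]
    rw [this, monomial_zero, ite_self]

/-- The `i`-th chain group of the Taylor complex as a family on all faces. -/
def extendFaces {R : Type*} [Zero R] (i : ℕ) (f : {A : Finset (Fin r) // A.card = i} → R)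
    (A : Finset (Fin r)) : R :=
  if h : A.card = i then f ⟨A, h⟩ else 0

variable (g) in
/-- The matrices of the Taylor complex. -/
def taylorMatrix (i : ℕ) : Matrix {A : Finset (Fin r) // A.card = i}
    {A : Finset (Fin r) // A.card = i + 1} (MvPolynomial (Fin n) K) :=
  Matrix.of fun A B => ∑ b ∈ A.1ᶜ, if insert b A.1 = B.1 then
    monomial (B.1.sup g - A.1.sup g) (incidenceSign K b A.1) else 0

lemma taylorMatrix_mulVec (i : ℕ) (f : {A : Finset (Fin r) // A.card = i + 1} →
    MvPolynomial (Fin n) K) (A : {A : Finset (Fin r) // A.card = i}) :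
    (taylorMatrix g i).mulVec f A = taylorDifferential g (extendFaces (i + 1) f) A.1 := by
  simp only [Matrix.mulVec, dotProduct, taylorMatrix, Matrix.of_apply, Finset.sum_mul,
    taylorDifferential]
  rw [Finset.sum_comm]
  refine Finset.sum_congr rfl fun b hb => ?_
  have hc : (insert b A.1).card = i + 1 := by
    rw [Finset.card_insert_of_notMem (by simpa using hb), A.2]
  rw [Finset.sum_eq_single ⟨insert b A.1, hc⟩]
  · rw [if_pos rfl, extendFaces, dif_pos hc]
  · intro B _ hB
    rw [if_neg fun h => hB (Subtype.ext h.symm), zero_mul]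
  · simp

lemma taylorMatrix_apply (i : ℕ) (A : {A : Finset (Fin r) // A.card = i})
    (B : {A : Finset (Fin r) // A.card = i + 1}) :
    taylorMatrix (K := K) g i A B = 0 ∨ ∃ b ∉ A.1, insert b A.1 = B.1 ∧
      taylorMatrix (K := K) g i A B =
        monomial (B.1.sup g - A.1.sup g) (incidenceSign K b A.1) := by
  by_cases h : ∃ b ∉ A.1, insert b A.1 = B.1
  · obtain ⟨b, hb, hbB⟩ := h
    refine Or.inr ⟨b, hb, hbB, ?_⟩
    rw [taylorMatrix, Matrix.of_apply, Finset.sum_eq_single_of_mem b (by simpa using hb),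
      if_pos hbB]
    intro c hc hcb
    rw [if_neg]
    intro hcB
    have h1 : c ∈ insert b A.1 := by
      rw [hbB, ← hcB]
      exact Finset.mem_insert_self _ _
    rcases Finset.mem_insert.1 h1 with h2 | h2
    · exact hcb h2
    · exact (Finset.mem_compl.1 hc) h2
  · left
    refine Finset.sum_eq_zero fun b hb => ?_
    rw [if_neg fun h' => h ⟨b, by simpa using hb, h'⟩]

lemma taylorDifferential_extendFaces {i : ℕ}
    {f : {A : Finset (Fin r) // A.card = i + 1} → MvPolynomial (Fin n) K}
    {A : Finset (Fin r)} (hA : A.card ≠ i) :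
    taylorDifferential g (extendFaces (i + 1) f) A = 0 := by
  refine Finset.sum_eq_zero fun b hb => ?_
  rw [extendFaces, dif_neg, mul_zero]
  rw [Finset.card_insert_of_notMem (by simpa using hb)]
  omega

lemma strand_extendFaces_ne {i : ℕ}
    {f : {A : Finset (Fin r) // A.card = i} → MvPolynomial (Fin n) K} {u : Fin n →₀ ℕ}
    {A : Finset (Fin r)} (hA : A.card ≠ i) : strand g (extendFaces i f) u A = 0 := by
  rw [strand, extendFaces, dif_neg hA, coeff_zero, ite_self]

/-- A family on all faces that lives on faces of a given cardinality has a preimage of the same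
kind under the Taylor differential. -/
lemma exists_taylorMatrix_mulVec_eq {i : ℕ}
    {f : {A : Finset (Fin r) // A.card = i} → MvPolynomial (Fin n) K}
    (h0 : ∀ u, (∀ j, ¬g j ≤ u) → ∀ A, strand g (extendFaces i f) u A = 0)
    (hD : ∀ A, taylorDifferential g (extendFaces i f) A = 0) :
    ∃ x, (taylorMatrix g i).mulVec x = f := by
  obtain ⟨H, hH, hH'⟩ := exists_taylorDifferential_eq _ h0 hD
  refine ⟨fun B => H B.1, ?_⟩
  have h1 : extendFaces (i + 1)
      (fun B : {A : Finset (Fin r) // A.card = i + 1} => H B.1) = H := by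
    ext1 B
    unfold extendFaces
    split_ifs with h
    · rfl
    · refine (hH' B fun v hv => dif_neg fun h' => h ?_).symm
      rw [← Finset.card_erase_add_one hv, h']
  ext1 A
  rw [taylorMatrix_mulVec, h1, hH, extendFaces, dif_pos A.2]

variable (g) in
/-- The Taylor resolution of a monomial ideal. It is minimal if the least common multiples of the
subsets of generators strictly increase. -/
def taylorResolution {M : Ideal (MvPolynomial (Fin n) K)}
    (hM : M = Ideal.span ((fun m => monomial m (1 : K)) '' Set.range g))
    (hg : ∀ A : Finset (Fin r), ∀ b ∉ A, ¬(insert b A).sup g ≤ A.sup g) :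
    MinimalGradedFreeResolution M where
  ι i := {A : Finset (Fin r) // A.card = i}
  deg i A := (A.1.sup g).degree
  D := taylorMatrix g
  aug _ := 1
  D_homogeneous i A B m hm := by
    rcases taylorMatrix_apply (K := K) (g := g) i A B with h | ⟨b, _, hb, h⟩
    · rw [h] at hm
      simp at hm
    · rw [h] at hm
      rw [Finset.mem_singleton.1 (support_monomial_subset hm), ← map_add,
        tsub_add_cancel_of_le (hb ▸ sup_le_sup_insert b A.1)]
  aug_homogeneous A := by
    have h : A.1 = ∅ := Finset.card_eq_zero.1 A.2
    rw [h, Finset.sup_empty, bot_eq_zero, map_zero]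
    refine ⟨1, ?_, map_one (Ideal.Quotient.mk M)⟩
    exact isHomogeneous_one (Fin n) K
  aug_surjective x := by
    obtain ⟨p, rfl⟩ := Ideal.Quotient.mk_surjective x
    refine ⟨fun A => p, ?_⟩
    rw [Fintype.linearCombination_apply, Fintype.sum_eq_single ⟨∅, rfl⟩]
    · exact congrArg (Ideal.Quotient.mk M) (mul_one _)
    · intro A hA
      exact absurd (Subtype.ext (Finset.card_eq_zero.1 A.2)) hA
  exact_aug f := by
    have haug : Fintype.linearCombination (MvPolynomial (Fin n) K)
        (fun _ : {A : Finset (Fin r) // A.card = 0} => (1 : MvPolynomial (Fin n) K ⧸ M)) f =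
        Ideal.Quotient.mk M (f ⟨∅, rfl⟩) := by
      rw [Fintype.linearCombination_apply, Fintype.sum_eq_single ⟨∅, rfl⟩]
      · exact congrArg (Ideal.Quotient.mk M) (mul_one _)
      · intro A hA
        exact absurd (Subtype.ext (Finset.card_eq_zero.1 A.2)) hA
    rw [haug, Ideal.Quotient.eq_zero_iff_mem]
    constructor
    · intro hf
      rw [hM, mem_ideal_span_monomial_image] at hf
      refine exists_taylorMatrix_mulVec_eq (fun u hu A => ?_) fun A => ?_
      · by_cases hA : A.card = 0
        · rw [Finset.card_eq_zero] at hA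
          subst hA
          by_contra hne
          rw [strand, if_pos (by simp), Finset.sup_empty, bot_eq_zero, tsub_zero] at hne
          obtain ⟨_, ⟨j, rfl⟩, hj⟩ := hf u (mem_support_iff.2 (by
            simpa [extendFaces] using hne))
          exact hu j hj
        · exact strand_extendFaces_ne hA
      · refine Finset.sum_eq_zero fun b _ => ?_
        rw [extendFaces, dif_neg (by simp), mul_zero]
    · rintro ⟨x, rfl⟩
      rw [Matrix.mulVecLin_apply, taylorMatrix_mulVec, taylorDifferential]
      refine Ideal.sum_mem _ fun b _ => Ideal.mul_mem_right _ _ ?_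
      rw [hM, mem_ideal_span_monomial_image]
      intro m hm
      rw [Finset.mem_singleton.1 (support_monomial_subset hm)]
      exact ⟨g b, ⟨b, rfl⟩, by simp [bot_eq_zero]⟩
  exact_D i f := by
    constructor
    · intro hf
      refine exists_taylorMatrix_mulVec_eq (fun u hu A => ?_) fun A => ?_
      · by_cases hA : A.card = i + 1
        · exact strand_eq_zero_of_forall_not_le (Finset.card_pos.1 (by omega)) hu
        · exact strand_extendFaces_ne hA
      · by_cases hA : A.card = i
        · rw [← taylorMatrix_mulVec i f ⟨A, hA⟩]
          exact congrFun hf _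
        · exact taylorDifferential_extendFaces hA
    · rintro ⟨x, rfl⟩
      ext1 A
      rw [Matrix.mulVecLin_apply, taylorMatrix_mulVec]
      have h1 : extendFaces (i + 1) ((taylorMatrix g (i + 1)).mulVecLin x) =
          taylorDifferential g (extendFaces (i + 2) x) := by
        ext1 B
        unfold extendFaces
        split_ifs with h
        · rw [Matrix.mulVecLin_apply, taylorMatrix_mulVec]
          rfl
        · exact (taylorDifferential_extendFaces h).symm
      rw [h1, taylorDifferential_taylorDifferential]
      rfl
  minimal i A B := by
    rcases taylorMatrix_apply (K := K) (g := g) i A B with h | ⟨b, hbA, hb, h⟩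
    · rw [h, map_zero]
    · rw [h, constantCoeff_monomial, if_neg]
      rw [tsub_eq_zero_iff_le, ← hb]
      exact hg A.1 b hbA

end Taylor

/-! ### Regularity -/

section Stars

variable {K : Type*} [Field K] {n r : ℕ}

lemma homogeneousComponent_mem_of_monomial {s : Set (Fin n →₀ ℕ)}
    {M : Ideal (MvPolynomial (Fin n) K)}
    (hM : M = Ideal.span ((fun m => monomial m (1 : K)) '' s)) :
    ∀ f ∈ M, ∀ j, homogeneousComponent j f ∈ M := by
  intro f hf j
  rw [hM, mem_ideal_span_monomial_image] at hf ⊢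
  intro m hm
  refine hf m ?_
  rw [mem_support_iff, coeff_homogeneousComponent] at hm
  rw [mem_support_iff]
  intro h
  simp [h] at hm

/-- The exponent vector of the product of the variables in `s`. -/
def indicatorExp (s : Finset (Fin n)) : Fin n →₀ ℕ := ∑ x ∈ s, Finsupp.single x 1

lemma indicatorExp_apply (s : Finset (Fin n)) (x : Fin n) :
    indicatorExp s x = if x ∈ s then 1 else 0 := by
  rw [indicatorExp, Finsupp.finsetSum_apply]
  simp [Finsupp.single_apply]

lemma degree_indicatorExp (s : Finset (Fin n)) : (indicatorExp s).degree = s.card := by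
  simp [indicatorExp]

/-- The exponent vectors of the quadratic monomials `x_{d i} x_{o i}`. -/
def quadric (d o : Fin r → Fin n) (i : Fin r) : Fin n →₀ ℕ :=
  Finsupp.single (d i) 1 + Finsupp.single (o i) 1

/-- The quadratic monomials `x_{d i} x_{o i}` form a disjoint union of stars: the variable
`x_{d i}` divides only the `i`-th monomial, unless that monomial is a square. -/
structure IsStarFamily (d o : Fin r → Fin n) : Prop where
  injective : Function.Injective d
  eq_of_eq : ∀ i j, d i = o j → d i = o i

lemma quadric_apply (d o : Fin r → Fin n) (i : Fin r) (x : Fin n) :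
    quadric d o i x = (if d i = x then 1 else 0) + if o i = x then 1 else 0 := by
  simp [quadric, Finsupp.single_apply]

variable {d o : Fin r → Fin n}

/-- A variable in both images gets exponent 2 on the right; the star condition makes its square one
of the generators in `A`. -/
lemma IsStarFamily.sup_quadric (h : IsStarFamily d o) (A : Finset (Fin r)) :
    A.sup (quadric d o) = indicatorExp (A.image d) + indicatorExp (A.image o) := by
  refine le_antisymm (Finset.sup_le fun i hi x => ?_) fun x => ?_
  · have h1 : d i ∈ A.image d := Finset.mem_image_of_mem _ hi
    have h2 : o i ∈ A.image o := Finset.mem_image_of_mem _ hi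
    rw [quadric_apply, Finsupp.add_apply, indicatorExp_apply, indicatorExp_apply]
    refine add_le_add ?_ ?_
    · split_ifs with h3 h4 <;> simp_all
    · split_ifs with h3 h4 <;> simp_all
  · rw [Finsupp.add_apply, indicatorExp_apply, indicatorExp_apply]
    have hle : ∀ i ∈ A, quadric d o i x ≤ A.sup (quadric d o) x := fun i hi =>
      Finset.le_sup (f := quadric d o) hi x
    by_cases h1 : x ∈ A.image d
    · obtain ⟨i, hi, rfl⟩ := Finset.mem_image.1 h1
      refine le_trans ?_ (hle i hi)
      rw [quadric_apply, if_pos h1, if_pos rfl]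
      split_ifs with h2 h3 <;> simp
      obtain ⟨j, _, hj⟩ := Finset.mem_image.1 h2
      exact h3 (h.eq_of_eq i j hj.symm).symm
    · rw [if_neg h1]
      split_ifs with h2
      · obtain ⟨i, hi, rfl⟩ := Finset.mem_image.1 h2
        refine le_trans ?_ (hle i hi)
        rw [quadric_apply, if_pos (rfl : o i = o i)]
        simp
      · simp

lemma IsStarFamily.degree_sup_quadric (h : IsStarFamily d o) (A : Finset (Fin r)) :
    (A.sup (quadric d o)).degree = A.card + (A.image o).card := by
  rw [h.sup_quadric, map_add, degree_indicatorExp, degree_indicatorExp,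
    Finset.card_image_of_injective _ h.injective]

/-- The degree `|A| + |o(A)|` strictly increases with `A`. This is the minimality of the Taylor
resolution. -/
lemma IsStarFamily.not_sup_insert_le (h : IsStarFamily d o) (A : Finset (Fin r)) (b : Fin r)
    (hb : b ∉ A) : ¬(insert b A).sup (quadric d o) ≤ A.sup (quadric d o) := by
  intro hle
  have h1 := Finsupp.degree_mono hle
  rw [h.degree_sup_quadric, h.degree_sup_quadric, Finset.card_insert_of_notMem hb] at h1
  have h2 := Finset.card_le_card (Finset.image_subset_image (f := o) (Finset.subset_insert b A))
  omega

lemma IsStarFamily.gradedBetti_ne_zero_iff (h : IsStarFamily d o)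
    {M : Ideal (MvPolynomial (Fin n) K)}
    (hM : M = Ideal.span ((fun m => monomial m (1 : K)) '' Set.range (quadric d o))) (i s : ℕ) :
    gradedBetti M i (i + s) ≠ 0 ↔
      ∃ A : Finset (Fin r), A.card = i ∧ (A.image o).card = s := by
  rw [MinimalGradedFreeResolution.gradedBetti_eq (homogeneousComponent_mem_of_monomial hM)
    (taylorResolution _ hM h.not_sup_insert_le)]
  change Nat.card {a : {A : Finset (Fin r) // A.card = i} //
    (a.1.sup (quadric d o)).degree = i + s} ≠ 0 ↔ _
  rw [Nat.card_ne_zero, and_iff_left (Subtype.finite)]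
  simp only [h.degree_sup_quadric]
  constructor
  · rintro ⟨⟨A, hA⟩, hs⟩
    exact ⟨A, hA, by dsimp only at hs; omega⟩
  · rintro ⟨A, hA, hs⟩
    exact ⟨⟨A, hA⟩, by dsimp only; omega⟩

lemma IsStarFamily.isGreatest (h : IsStarFamily d o)
    {M : Ideal (MvPolynomial (Fin n) K)}
    (hM : M = Ideal.span ((fun m => monomial m (1 : K)) '' Set.range (quadric d o))) :
    IsGreatest {s : ℕ | ∃ i : ℕ, gradedBetti M i (i + s) ≠ 0} (Finset.univ.image o).card := by
  simp only [h.gradedBetti_ne_zero_iff hM]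
  refine ⟨⟨_, Finset.univ, rfl, rfl⟩, ?_⟩
  rintro s ⟨i, A, _, rfl⟩
  exact Finset.card_le_card (Finset.image_subset_image (Finset.subset_univ A))

lemma IsStarFamily.regularity_eq (h : IsStarFamily d o)
    {M : Ideal (MvPolynomial (Fin n) K)}
    (hM : M = Ideal.span ((fun m => monomial m (1 : K)) '' Set.range (quadric d o))) :
    regularity M = (Finset.univ.image o).card :=
  (h.isGreatest hM).csSup_eq

end Stars

/-! ### Height -/

section Height

variable {K : Type*} [Field K] {n r : ℕ}

/-- The ideal is the kernel of the endomorphism killing the variables in `s`, since that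
endomorphism is the identity modulo the ideal. -/
lemma isPrime_span_X_image (s : Set (Fin n)) :
    (Ideal.span (X '' s : Set (MvPolynomial (Fin n) K))).IsPrime := by
  classical
  let φ : MvPolynomial (Fin n) K →ₐ[K] MvPolynomial (Fin n) K :=
    aeval fun x => if x ∈ s then 0 else X x
  have h1 : Ideal.span (X '' s : Set (MvPolynomial (Fin n) K)) = RingHom.ker φ := by
    refine le_antisymm (Ideal.span_le.2 ?_) fun f hf => ?_
    · rintro _ ⟨x, hx, rfl⟩
      simp [φ, hx]
    · set I := Ideal.span (X '' s : Set (MvPolynomial (Fin n) K))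
      have h2 : (Ideal.Quotient.mkₐ K I).comp φ = Ideal.Quotient.mkₐ K I := by
        ext x
        by_cases hx : x ∈ s
        · have h3 : (X x : MvPolynomial (Fin n) K) ∈ I := Ideal.subset_span ⟨x, hx, rfl⟩
          simpa [φ, hx] using (Ideal.Quotient.eq_zero_iff_mem.2 h3).symm
        · simp [φ, hx]
      have h4 := AlgHom.congr_fun h2 f
      rw [AlgHom.comp_apply, (RingHom.mem_ker).1 hf, map_zero] at h4
      exact Ideal.Quotient.eq_zero_iff_mem.1 h4.symm
  rw [h1]
  exact RingHom.ker_isPrime _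

lemma X_mem_span_X_image {s : Set (Fin n)} {x : Fin n} :
    (X x : MvPolynomial (Fin n) K) ∈ Ideal.span (X '' s) ↔ x ∈ s := by
  rw [mem_ideal_span_X_image]
  simp [support_X, Finsupp.single_apply]

lemma card_le_height_span_X_image (s : Finset (Fin n)) :
    (s.card : ℕ∞) ≤ (Ideal.span (X '' (s : Set (Fin n)) : Set (MvPolynomial (Fin n) K))).height := by
  induction s using Finset.induction_on with
  | empty => simp
  | insert a s ha ih =>
    have := isPrime_span_X_image (K := K) (s : Set (Fin n))
    have := isPrime_span_X_image (K := K) ((insert a s : Finset (Fin n)) : Set (Fin n))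
    rw [Finset.card_insert_of_notMem ha, Nat.cast_add, Nat.cast_one]
    refine (add_le_add_left ih 1).trans (Ideal.height_add_one_le_of_lt_of_isPrime ?_)
    refine lt_of_le_of_ne (Ideal.span_mono (Set.image_mono (by simp))) fun h => ha ?_
    have h1 : (X a : MvPolynomial (Fin n) K) ∈
        Ideal.span (X '' ((insert a s : Finset (Fin n)) : Set (Fin n))) :=
      X_mem_span_X_image.2 (by simp)
    rw [← h] at h1
    exact X_mem_span_X_image.1 h1

lemma height_span_X_image_le (s : Finset (Fin n)) :
    (Ideal.span (X '' (s : Set (Fin n)) : Set (MvPolynomial (Fin n) K))).height ≤ s.card := by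
  classical
  refine (Ideal.height_le_spanFinrank _ (isPrime_span_X_image _).ne_top).trans ?_
  rw [Nat.cast_le]
  refine (Submodule.spanFinrank_span_le_ncard_of_finite (s.finite_toSet.image _)).trans ?_
  exact (Set.ncard_image_le s.finite_toSet).trans (Set.ncard_coe_finset s).le

variable {d o : Fin r → Fin n}

lemma monomial_quadric (i : Fin r) :
    monomial (quadric d o i) (1 : K) = X (d i) * X (o i) := by
  rw [quadric, X, X, monomial_mul, one_mul]

lemma IsStarFamily.codim_eq (h : IsStarFamily d o) {M : Ideal (MvPolynomial (Fin n) K)}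
    (hM : M = Ideal.span ((fun m => monomial m (1 : K)) '' Set.range (quadric d o))) :
    codim M = ((Finset.univ.image o).card : ℕ∞) := by
  refine le_antisymm ?_ ?_
  · refine (Ideal.height_mono ?_).trans (height_span_X_image_le (K := K) (Finset.univ.image o))
    rw [hM, Ideal.span_le]
    rintro _ ⟨_, ⟨i, rfl⟩, rfl⟩
    simp only [monomial_quadric]
    exact Ideal.mul_mem_left _ _ (X_mem_span_X_image.2 (by simp))
  · rw [codim, Ideal.height_eq_inf_minimalPrimes]
    refine le_iInf₂ fun P hP => ?_
    have hPp : P.IsPrime := hP.1.1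
    have hmem : ∀ i, (X (d i) : MvPolynomial (Fin n) K) ∈ P ∨
        (X (o i) : MvPolynomial (Fin n) K) ∈ P := by
      intro i
      refine hPp.mem_or_mem (hP.1.2 ?_)
      rw [hM, ← monomial_quadric]
      exact Ideal.subset_span ⟨_, ⟨i, rfl⟩, rfl⟩
    have hex : ∀ x ∈ Finset.univ.image o, ∃ i, o i = x := by
      intro x hx
      simpa using hx
    rcases isEmpty_or_nonempty (Fin r) with hr | hr
    · simp
    choose! m hm using hex
    classical
    -- For each center, a variable of its star that lies in `P`: the center itself, or else the
    -- dominant variable of a chosen edge.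
    let f : Fin n → Fin n := fun x =>
      if (X x : MvPolynomial (Fin n) K) ∈ P then x else d (m x)
    have hfP : ∀ x ∈ Finset.univ.image o, (X (f x) : MvPolynomial (Fin n) K) ∈ P := by
      intro x hx
      simp only [f]
      split_ifs with hxP
      · exact hxP
      · exact (hmem (m x)).resolve_right (by rwa [hm x hx])
    have hinj : Set.InjOn f (Finset.univ.image o : Finset (Fin n)) := by
      intro x hx y hy hxy
      rw [Finset.mem_coe] at hx hy
      -- A dominant variable that is a center is the center of its own edge.
      have aux : ∀ x ∈ Finset.univ.image o, ∀ y ∈ Finset.univ.image o, x = d (m y) → x = y := by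
        intro x hx y hy hxy
        have h1 := h.eq_of_eq (m y) (m x) (by rw [hm x hx, hxy])
        rw [hxy, h1, hm y hy]
      simp only [f] at hxy
      split_ifs at hxy
      · exact hxy
      · exact aux x hx y hy hxy
      · exact (aux y hy x hx hxy.symm).symm
      · rw [← hm x hx, ← hm y hy, h.injective hxy]
    rw [← Finset.card_image_of_injOn hinj]
    refine (card_le_height_span_X_image (K := K) _).trans (Ideal.height_mono ?_)
    rw [Ideal.span_le]
    rintro _ ⟨y, hy, rfl⟩
    obtain ⟨x, hx, rfl⟩ := Finset.mem_image.1 hy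
    exact hfP x hx

end Height

/-! ### The Hilbert function of a monomial ideal -/

section Standard

variable {K : Type*} [Field K] {n : ℕ}

lemma linearIndependent_standard {s : Set (Fin n →₀ ℕ)} {M : Ideal (MvPolynomial (Fin n) K)}
    (hM : M = Ideal.span ((fun m => monomial m (1 : K)) '' s)) (W : Finset (Fin n →₀ ℕ))
    (hW : ∀ u ∈ W, ∀ m ∈ s, ¬m ≤ u) :
    LinearIndependent K (fun u : W => Ideal.Quotient.mkₐ K M (monomial u.1 (1 : K))) := by
  classical
  rw [Fintype.linearIndependent_iff]
  intro c hc u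
  have h1 : Ideal.Quotient.mkₐ K M (∑ u : W, monomial u.1 (c u)) = 0 := by
    rw [← hc, map_sum]
    refine Finset.sum_congr rfl fun u _ => ?_
    rw [← map_smul, smul_monomial, smul_eq_mul, mul_one]
  have h2 : ∑ u : W, monomial u.1 (c u) ∈ M := Ideal.Quotient.eq_zero_iff_mem.1 h1
  rw [hM, mem_ideal_span_monomial_image] at h2
  by_contra h0
  obtain ⟨m, hm, hmu⟩ := h2 u.1 (by
    rw [mem_support_iff, coeff_sum, Finset.sum_eq_single u]
    · rwa [coeff_monomial, if_pos rfl]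
    · intro v _ hv
      rw [coeff_monomial, if_neg fun h => hv (Subtype.ext h)]
    · simp)
  exact hW u.1 u.2 m hm hmu

/-- Stated for a subspace `N` so as to cover both the graded pieces and, with `N = ⊤`, the whole
quotient. -/
lemma finrank_map_mk_eq_card {s : Set (Fin n →₀ ℕ)} {M : Ideal (MvPolynomial (Fin n) K)}
    (hM : M = Ideal.span ((fun m => monomial m (1 : K)) '' s))
    {N : Submodule K (MvPolynomial (Fin n) K)} (W : Finset (Fin n →₀ ℕ))
    (hW : ∀ u ∈ W, ∀ m ∈ s, ¬m ≤ u) (hWN : ∀ u ∈ W, monomial u (1 : K) ∈ N)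
    (hN : ∀ p ∈ N, ∀ u ∈ p.support, (∀ m ∈ s, ¬m ≤ u) → u ∈ W) :
    Module.finrank K (N.map (Ideal.Quotient.mkₐ K M).toLinearMap) = W.card := by
  suffices hs : N.map (Ideal.Quotient.mkₐ K M).toLinearMap = Submodule.span K
      (Set.range fun u : W => Ideal.Quotient.mkₐ K M (monomial u.1 (1 : K))) by
    rw [hs, finrank_span_eq_card (linearIndependent_standard hM W hW), Fintype.card_coe]
  refine le_antisymm ?_ (Submodule.span_le.2 ?_)
  · rintro _ ⟨p, hp, rfl⟩
    rw [AlgHom.toLinearMap_apply, p.as_sum, map_sum]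
    refine Submodule.sum_mem _ fun u hu => ?_
    by_cases h : ∀ m ∈ s, ¬m ≤ u
    · rw [← mul_one (coeff u p), ← smul_eq_mul, ← smul_monomial, map_smul]
      exact Submodule.smul_mem _ _ (Submodule.subset_span ⟨⟨u, hN p hp u hu h⟩, rfl⟩)
    · push Not at h
      have h1 : monomial u (coeff u p) ∈ M := by
        rw [hM, mem_ideal_span_monomial_image]
        intro v hv
        rw [Finset.mem_singleton.1 (support_monomial_subset hv)]
        exact h
      have h2 : Ideal.Quotient.mkₐ K M (monomial u (coeff u p)) = 0 :=
        Ideal.Quotient.eq_zero_iff_mem.2 h1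
      rw [h2]
      exact Submodule.zero_mem _
  · rintro _ ⟨u, rfl⟩
    exact ⟨_, hWN u.1 u.2, rfl⟩

open Classical in
lemma hilbertFunction_eq_card {s : Set (Fin n →₀ ℕ)} {M : Ideal (MvPolynomial (Fin n) K)}
    (hM : M = Ideal.span ((fun m => monomial m (1 : K)) '' s)) (e : ℕ) :
    hilbertFunction M e =
      ((Finset.univ.finsuppAntidiag e).filter fun u : Fin n →₀ ℕ => ∀ m ∈ s, ¬m ≤ u).card := by
  have hdeg : ∀ u : Fin n →₀ ℕ, u ∈ Finset.univ.finsuppAntidiag e ↔ u.degree = e := by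
    intro u
    rw [Finset.mem_finsuppAntidiag, Finsupp.degree_eq_sum]
    simp
  refine finrank_map_mk_eq_card hM _ (fun u hu => (Finset.mem_filter.1 hu).2) (fun u hu => ?_)
    fun p hp u hu h => Finset.mem_filter.2 ⟨(hdeg u).2 ?_, h⟩
  · exact isHomogeneous_monomial _ ((hdeg u).1 (Finset.mem_filter.1 hu).1)
  · rw [Finsupp.degree_eq_weight_one]
    exact hp (mem_support_iff.1 hu)

lemma finrank_quotient_eq_card {s : Set (Fin n →₀ ℕ)} {M : Ideal (MvPolynomial (Fin n) K)}
    (hM : M = Ideal.span ((fun m => monomial m (1 : K)) '' s)) (W : Finset (Fin n →₀ ℕ))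
    (hW : ∀ u, u ∈ W ↔ ∀ m ∈ s, ¬m ≤ u) :
    Module.finrank K (MvPolynomial (Fin n) K ⧸ M) = W.card := by
  rw [← finrank_map_mk_eq_card (N := ⊤) hM W (fun u hu => (hW u).1 hu) (fun _ _ => trivial)
    fun p _ u _ h => (hW u).2 h, Submodule.map_top, LinearMap.range_eq_top.2, finrank_top]
  exact Ideal.Quotient.mkₐ_surjective K M

lemma IsHilbertPolynomial.unique {M : Ideal (MvPolynomial (Fin n) K)} {P Q : Polynomial ℚ}
    (hP : IsHilbertPolynomial M P) (hQ : IsHilbertPolynomial M Q) : P = Q := by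
  obtain ⟨N, hN⟩ := eventually_atTop.1 (hP.and hQ)
  refine Polynomial.eq_of_infinite_eval_eq P Q (Set.Infinite.mono ?_
    ((Set.Ici_infinite N).image (Nat.cast_injective (R := ℚ)).injOn))
  rintro _ ⟨e, he, rfl⟩
  exact (hN e he).1.symm.trans (hN e he).2

lemma IsHilbertPolynomial.multiplicity_eq {M : Ideal (MvPolynomial (Fin n) K)}
    {P : Polynomial ℚ} (hP : IsHilbertPolynomial M P) : multiplicity M =
      if P = 0 then (Module.finrank K (MvPolynomial (Fin n) K ⧸ M) : ℚ)
      else (P.natDegree.factorial : ℚ) * P.leadingCoeff := by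
  classical
  have h : ∃ P : Polynomial ℚ, IsHilbertPolynomial M P := ⟨P, hP⟩
  rw [multiplicity, dif_pos h, h.choose_spec.unique hP]

end Standard

/-! ### Standard monomials of a star family -/

section Count

variable {K : Type*} [Field K] {n r : ℕ} {d o : Fin r → Fin n}

/-- The variables that may occur freely in a standard monomial whose set of center variables
is `T`. -/
def freeVars (d o : Fin r → Fin n) (T : Finset (Fin n)) : Finset (Fin n) :=
  (((Finset.univ.filter fun i => o i ∈ T).image d) ∪ (Finset.univ.image o \ T))ᶜ

lemma mem_freeVars {T : Finset (Fin n)} {x : Fin n} :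
    x ∈ freeVars d o T ↔ (∀ i, o i ∈ T → d i ≠ x) ∧ (x ∈ Finset.univ.image o → x ∈ T) := by
  simp only [freeVars, Finset.mem_compl, Finset.mem_union, Finset.mem_sdiff, not_or, not_and,
    not_not]
  refine and_congr ?_ Iff.rfl
  simp

/-- The two families of excluded variables are disjoint: a dominant variable of an edge centered in
`T`, if itself a center, is that edge's center and so lies in `T`. -/
lemma IsStarFamily.card_freeVars (h : IsStarFamily d o) {T : Finset (Fin n)}
    (hT : T ⊆ Finset.univ.image o) :
    (freeVars d o T).card + (Finset.univ.image o).card +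
      (Finset.univ.filter fun i => o i ∈ T).card = n + T.card := by
  have hdisj : Disjoint ((Finset.univ.filter fun i => o i ∈ T).image d)
      (Finset.univ.image o \ T) := by
    rw [Finset.disjoint_left]
    intro x hx hx'
    obtain ⟨i, hi, rfl⟩ := Finset.mem_image.1 hx
    rw [Finset.mem_sdiff] at hx'
    obtain ⟨j, _, hj⟩ := Finset.mem_image.1 hx'.1
    apply hx'.2
    rw [h.eq_of_eq i j hj.symm]
    exact (Finset.mem_filter.1 hi).2
  have h1 := Finset.card_add_card_compl
    (((Finset.univ.filter fun i => o i ∈ T).image d) ∪ (Finset.univ.image o \ T))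
  rw [Finset.card_union_of_disjoint hdisj, Finset.card_image_of_injective _ h.injective,
    Fintype.card_fin] at h1
  have h2 := Finset.card_sdiff_add_card_eq_card hT
  rw [freeVars]
  omega

lemma quadric_le_iff (i : Fin r) (u : Fin n →₀ ℕ) :
    quadric d o i ≤ u ↔ if d i = o i then 2 ≤ u (d i) else 1 ≤ u (d i) ∧ 1 ≤ u (o i) := by
  constructor
  · intro hle
    have h1 := hle (d i)
    have h2 := hle (o i)
    rw [quadric_apply] at h1 h2
    split_ifs with h
    · simpa [h] using h1
    · simp only [if_pos, if_neg h, if_neg (Ne.symm h)] at h1 h2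
      omega
  · intro hu x
    rw [quadric_apply]
    split_ifs at hu with h
    · by_cases hx : d i = x
      · subst hx
        simpa [← h] using hu
      · simp [hx, ← h]
    · by_cases hx : d i = x
      · subst hx
        simpa [Ne.symm h] using hu.1
      · by_cases hx' : o i = x
        · subst hx'
          simpa [hx] using hu.2
        · simp [hx, hx']

/-- Once the centers in `T` divide `u`, the dominant variables of their edges are forbidden. For a
loop this means that the center occurs exactly once; other centers in `T` may have any positive
exponent. -/
lemma IsStarFamily.standard_iff (h : IsStarFamily d o) {T : Finset (Fin n)}
    (hT : T ⊆ Finset.univ.image o) (u : Fin n →₀ ℕ) :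
    ((∀ i, ¬quadric d o i ≤ u) ∧ u.support ∩ Finset.univ.image o = T) ↔
      ∃ w : Fin n →₀ ℕ, w.support ⊆ freeVars d o T ∧ w + indicatorExp T = u := by
  constructor
  · rintro ⟨hu, rfl⟩
    set T := u.support ∩ Finset.univ.image o with hTdef
    have hle : indicatorExp T ≤ u := by
      intro x
      rw [indicatorExp_apply]
      split_ifs with hx
      · exact Nat.one_le_iff_ne_zero.2 (Finsupp.mem_support_iff.1 (Finset.mem_inter.1 hx).1)
      · exact Nat.zero_le _
    refine ⟨u - indicatorExp T, fun x hx => ?_, tsub_add_cancel_of_le hle⟩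
    rw [Finsupp.mem_support_iff, Finsupp.tsub_apply, indicatorExp_apply] at hx
    refine mem_freeVars.2 ⟨?_, fun hxo => ?_⟩
    · rintro i hi rfl
      apply hu i
      rw [quadric_le_iff]
      have h1 : u (o i) ≠ 0 := Finsupp.mem_support_iff.1 (Finset.mem_inter.1 hi).1
      split_ifs with hdo
      · rw [hdo, if_pos hi] at hx
        rw [hdo]
        omega
      · omega
    · rw [hTdef, Finset.mem_inter, Finsupp.mem_support_iff]
      exact ⟨by omega, hxo⟩
  · rintro ⟨w, hw, rfl⟩
    have hw0 : ∀ x, x ∉ freeVars d o T → w x = 0 := fun x hx =>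
      Finsupp.notMem_support_iff.1 fun h' => hx (hw h')
    have hsupp : ∀ x ∈ Finset.univ.image o, (w + indicatorExp T) x ≠ 0 → x ∈ T := by
      intro x hxo hx
      by_contra hxT
      rw [Finsupp.add_apply, indicatorExp_apply, if_neg hxT,
        hw0 x fun h' => hxT ((mem_freeVars.1 h').2 hxo)] at hx
      exact hx rfl
    refine ⟨fun i hi => ?_, ?_⟩
    · rw [quadric_le_iff] at hi
      have hoi : o i ∈ T := by
        refine hsupp _ (Finset.mem_image_of_mem _ (Finset.mem_univ i)) ?_
        split_ifs at hi with hdo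
        · rw [hdo] at hi
          omega
        · omega
      have h0 : w (d i) = 0 := hw0 _ fun h' => (mem_freeVars.1 h').1 i hoi rfl
      rw [Finsupp.add_apply, indicatorExp_apply, h0] at hi
      split_ifs at hi with hdo hdT hdT
      · omega
      · omega
      · obtain ⟨j, _, hj⟩ := Finset.mem_image.1 (hT hdT)
        exact hdo (h.eq_of_eq i j hj.symm)
      · omega
    · ext x
      rw [Finset.mem_inter, Finsupp.mem_support_iff]
      refine ⟨fun hx => hsupp x hx.2 hx.1, fun hx => ⟨?_, hT hx⟩⟩
      rw [Finsupp.add_apply, indicatorExp_apply, if_pos hx]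
      omega

/-- The bound `n ≤ e` keeps the subtraction `e - T.card` from truncating. -/
lemma IsStarFamily.hilbertFunction_eq (h : IsStarFamily d o)
    {M : Ideal (MvPolynomial (Fin n) K)}
    (hM : M = Ideal.span ((fun m => monomial m (1 : K)) '' Set.range (quadric d o)))
    {e : ℕ} (he : n ≤ e) :
    hilbertFunction M e = ∑ T ∈ (Finset.univ.image o).powerset,
      ((freeVars d o T).finsuppAntidiag (e - T.card)).card := by
  classical
  rw [hilbertFunction_eq_card hM, Finset.card_eq_sum_card_fiberwise
    (f := fun u => u.support ∩ Finset.univ.image o) (t := (Finset.univ.image o).powerset)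
    (fun u _ => by simp)]
  refine Finset.sum_congr rfl fun T hT => ?_
  rw [Finset.mem_powerset] at hT
  have hTn : T.card ≤ n := by simpa using Finset.card_le_univ T
  have hmem : ∀ (V : Finset (Fin n)) (e : ℕ) (u : Fin n →₀ ℕ),
      u ∈ V.finsuppAntidiag e ↔ u.degree = e ∧ u.support ⊆ V := by
    intro V e u
    rw [Finset.mem_finsuppAntidiag]
    refine and_congr_left fun hu => ?_
    rw [Finsupp.degree_apply, Finset.sum_subset hu fun x _ hx => Finsupp.notMem_support_iff.1 hx]
  symm
  refine Finset.card_nbij (fun w => w + indicatorExp T) (fun w hw => ?_)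
    (fun a _ b _ hab => add_right_cancel hab) fun u hu => ?_
  · rw [Finset.mem_coe, hmem] at hw
    have h1 := (h.standard_iff hT (w + indicatorExp T)).2 ⟨w, hw.2, rfl⟩
    simp only [Finset.coe_filter, Set.mem_ofPred_eq, Finset.mem_filter, Set.forall_mem_range, hmem]
    refine ⟨⟨⟨?_, Finset.subset_univ _⟩, h1.1⟩, h1.2⟩
    rw [map_add, degree_indicatorExp, hw.1]
    omega
  · simp only [Finset.coe_filter, Set.mem_ofPred_eq, Finset.mem_filter, Set.forall_mem_range,
      hmem] at hu
    obtain ⟨w, hw, rfl⟩ := (h.standard_iff hT u).1 ⟨hu.1.2, hu.2⟩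
    refine ⟨w, ?_, rfl⟩
    have h1 := hu.1.1.1
    rw [map_add, degree_indicatorExp] at h1
    rw [Finset.mem_coe, hmem]
    exact ⟨by omega, hw⟩

end Count

/-! ### Multiplicity -/

section Multiplicity

variable {K : Type*} [Field K] {n r : ℕ} {d o : Fin r → Fin n}

lemma card_filter_mem_eq_sum (T : Finset (Fin n)) :
    (Finset.univ.filter fun i => o i ∈ T).card =
      ∑ x ∈ T, (Finset.univ.filter fun i => o i = x).card := by
  rw [Finset.card_eq_sum_card_fiberwise (f := o) (t := T) (fun i hi => by simpa using hi)]
  refine Finset.sum_congr rfl fun x hx => ?_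
  congr 1
  ext i
  simp only [Finset.mem_filter, Finset.mem_univ, true_and, and_iff_right_iff_imp]
  rintro rfl
  exact hx

lemma one_le_card_fiber {x : Fin n} (hx : x ∈ Finset.univ.image o) :
    1 ≤ (Finset.univ.filter fun i => o i = x).card := by
  obtain ⟨i, _, hi⟩ := Finset.mem_image.1 hx
  exact Finset.card_pos.2 ⟨i, by simpa using hi⟩

lemma card_le_card_filter_mem {T : Finset (Fin n)} (hT : T ⊆ Finset.univ.image o) :
    T.card ≤ (Finset.univ.filter fun i => o i ∈ T).card := by
  rw [card_filter_mem_eq_sum, Finset.card_eq_sum_ones]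
  exact Finset.sum_le_sum fun x hx => one_le_card_fiber (hT hx)

lemma card_eq_card_filter_mem_iff {T : Finset (Fin n)} (hT : T ⊆ Finset.univ.image o) :
    T.card = (Finset.univ.filter fun i => o i ∈ T).card ↔
      ∀ x ∈ T, (Finset.univ.filter fun i => o i = x).card = 1 := by
  rw [card_filter_mem_eq_sum, Finset.card_eq_sum_ones,
    Finset.sum_eq_sum_iff_of_le fun x hx => one_le_card_fiber (hT hx)]
  simp only [eq_comm]

/-- The variables that are the center of a star with exactly one edge. -/
def simpleCenters (o : Fin r → Fin n) : Finset (Fin n) :=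
  (Finset.univ.image o).filter fun x => (Finset.univ.filter fun i => o i = x).card = 1

/-- These are the `T` of maximal growth: every center has at least one edge, so no free variable is
lost exactly when each center in `T` has only one. -/
lemma IsStarFamily.filter_card_freeVars (h : IsStarFamily d o) :
    ((Finset.univ.image o).powerset.filter fun T =>
      (freeVars d o T).card + (Finset.univ.image o).card = n) = (simpleCenters o).powerset := by
  ext T
  rw [Finset.mem_filter, Finset.mem_powerset, Finset.mem_powerset, simpleCenters]
  have hsub : T ⊆ (Finset.univ.image o).filter
      (fun x => (Finset.univ.filter fun i => o i = x).card = 1) ↔ T ⊆ Finset.univ.image o ∧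
      ∀ x ∈ T, (Finset.univ.filter fun i => o i = x).card = 1 := by
    simp only [Finset.subset_iff, Finset.mem_filter, forall_and]
  rw [hsub]
  refine and_congr_right fun hT => ?_
  rw [← card_eq_card_filter_mem_iff hT]
  have h1 := h.card_freeVars hT
  omega

lemma IsStarFamily.card_freeVars_le (h : IsStarFamily d o) {T : Finset (Fin n)}
    (hT : T ⊆ Finset.univ.image o) :
    (freeVars d o T).card + (Finset.univ.image o).card ≤ n := by
  have h1 := h.card_freeVars hT
  have h2 := card_le_card_filter_mem hT
  omega

/-- The Hilbert polynomial of the ideal of a star family. -/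
def starHilbertPoly (d o : Fin r → Fin n) : Polynomial ℚ :=
  -- Without free variables `T` contributes only the monomial `x_T`, invisible in large degrees.
  -- Otherwise, with `f` free variables, it contributes `e ↦ (e - |T| + f - 1).choose (f - 1)`.
  ∑ T ∈ (Finset.univ.image o).powerset, if (freeVars d o T).card = 0 then 0 else
    Polynomial.preHilbertPoly ℚ ((freeVars d o T).card - 1) T.card

lemma IsStarFamily.isHilbertPolynomial (h : IsStarFamily d o)
    {M : Ideal (MvPolynomial (Fin n) K)}
    (hM : M = Ideal.span ((fun m => monomial m (1 : K)) '' Set.range (quadric d o))) :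
    IsHilbertPolynomial M (starHilbertPoly d o) := by
  -- The bound `n + 1` gives `e - T.card > 0`, so the terms without free variables vanish.
  filter_upwards [eventually_ge_atTop (n + 1)] with e he
  rw [h.hilbertFunction_eq hM (by omega), starHilbertPoly, Polynomial.eval_finsetSum,
    Nat.cast_sum]
  refine Finset.sum_congr rfl fun T _ => ?_
  have hTn : T.card ≤ n := by simpa using Finset.card_le_univ T
  split_ifs with h0
  · rw [Finset.card_eq_zero] at h0
    rw [h0, Finset.finsuppAntidiag_empty_of_ne_zero (by omega)]
    simp
  · rw [Polynomial.preHilbertPoly_eq_choose_sub_add ℚ _ (by omega),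
      Finset.card_finsuppAntidiag_nat_eq_choose, Nat.cast_inj,
      show (freeVars d o T).card + (e - T.card) - 1 =
        e - T.card + ((freeVars d o T).card - 1) by omega, Nat.choose_symm_add]

lemma indicatorExp_injective : Function.Injective (indicatorExp (n := n)) := by
  intro s t hst
  ext x
  have h1 := DFunLike.congr_fun hst x
  rw [indicatorExp_apply, indicatorExp_apply] at h1
  split_ifs at h1 <;> simp_all

lemma IsStarFamily.finrank_quotient (h : IsStarFamily d o)
    {M : Ideal (MvPolynomial (Fin n) K)}
    (hM : M = Ideal.span ((fun m => monomial m (1 : K)) '' Set.range (quadric d o)))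
    (hn : (Finset.univ.image o).card = n) :
    Module.finrank K (MvPolynomial (Fin n) K ⧸ M) = 2 ^ (Finset.univ.image o).card := by
  classical
  have hfree : ∀ T ⊆ Finset.univ.image o, freeVars d o T = ∅ := by
    intro T hT
    have := h.card_freeVars_le hT
    exact Finset.card_eq_zero.1 (by omega)
  rw [finrank_quotient_eq_card hM ((Finset.univ.image o).powerset.image indicatorExp),
    Finset.card_image_of_injective _ indicatorExp_injective, Finset.card_powerset]
  intro u
  rw [Set.forall_mem_range, Finset.mem_image]
  constructor
  · rintro ⟨T, hT, rfl⟩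
    rw [Finset.mem_powerset] at hT
    exact ((h.standard_iff hT _).2 ⟨0, by simp, zero_add _⟩).1
  · intro hu
    obtain ⟨w, hw, hwu⟩ := (h.standard_iff Finset.inter_subset_right u).1 ⟨hu, rfl⟩
    rw [hfree _ Finset.inter_subset_right, Finset.subset_empty, Finsupp.support_eq_empty] at hw
    rw [hw, zero_add] at hwu
    exact ⟨_, Finset.mem_powerset.2 Finset.inter_subset_right, hwu⟩

/-- If `c < n`, each set of one-edge centers contributes `1 / D!` in the top degree `D = n - c - 1`.
If `c = n`, the Hilbert polynomial is zero, and every center has a single edge. -/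
theorem IsStarFamily.multiplicity_eq (h : IsStarFamily d o)
    {M : Ideal (MvPolynomial (Fin n) K)}
    (hM : M = Ideal.span ((fun m => monomial m (1 : K)) '' Set.range (quadric d o))) :
    multiplicity M = 2 ^ (simpleCenters o).card := by
  rw [(h.isHilbertPolynomial hM).multiplicity_eq]
  have hle : (Finset.univ.image o).card ≤ n := by
    simpa using Finset.card_le_univ (Finset.univ.image o)
  rcases hle.eq_or_lt with hn | hn
  · have hP : starHilbertPoly d o = 0 := by
      refine Finset.sum_eq_zero fun T hT => if_pos ?_
      have := h.card_freeVars_le (Finset.mem_powerset.1 hT)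
      omega
    have hs : Finset.univ.image o = simpleCenters o := by
      refine (Finset.mem_powerset.1 ?_).antisymm (Finset.filter_subset _ _)
      rw [← h.filter_card_freeVars, Finset.mem_filter]
      have := h.card_freeVars_le (Finset.Subset.refl _)
      exact ⟨Finset.mem_powerset_self _, by omega⟩
    rw [if_pos hP, h.finrank_quotient hM hn, ← hs]
    simp
  · set D := n - (Finset.univ.image o).card - 1 with hD
    have hcoeff : (starHilbertPoly d o).coeff D =
        2 ^ (simpleCenters o).card * (D.factorial : ℚ)⁻¹ := by
      rw [starHilbertPoly, Polynomial.finsetSum_coeff]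
      have hterm : ∀ T ∈ (Finset.univ.image o).powerset,
          (if (freeVars d o T).card = 0 then 0 else
            Polynomial.preHilbertPoly ℚ ((freeVars d o T).card - 1) T.card).coeff D =
          if (freeVars d o T).card + (Finset.univ.image o).card = n then
            (D.factorial : ℚ)⁻¹ else 0 := by
        intro T hT
        have h1 := h.card_freeVars_le (Finset.mem_powerset.1 hT)
        by_cases h2 : (freeVars d o T).card + (Finset.univ.image o).card = n
        · rw [if_pos h2, if_neg (by omega),
            show (freeVars d o T).card - 1 = D by omega, Polynomial.coeff_preHilbertPoly_self]
        · rw [if_neg h2]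
          split_ifs with h3
          · simp
          · apply Polynomial.coeff_eq_zero_of_natDegree_lt
            rw [Polynomial.natDegree_preHilbertPoly]
            omega
      rw [Finset.sum_congr rfl hterm, ← Finset.sum_filter, h.filter_card_freeVars,
        Finset.sum_const, Finset.card_powerset, nsmul_eq_mul]
      push_cast
      rfl
    have hne : (starHilbertPoly d o).coeff D ≠ 0 := by
      rw [hcoeff]
      positivity
    have hdeg : (starHilbertPoly d o).natDegree = D := by
      refine le_antisymm ?_ (Polynomial.le_natDegree_of_ne_zero hne)
      refine Polynomial.natDegree_sum_le_of_forall_le _ _ fun T hT => ?_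
      have h1 := h.card_freeVars_le (Finset.mem_powerset.1 hT)
      split_ifs
      · simp
      · rw [Polynomial.natDegree_preHilbertPoly]
        omega
    rw [if_neg fun h0 => hne (by rw [h0, Polynomial.coeff_zero]), Polynomial.leadingCoeff, hdeg,
      hcoeff]
    have : (D.factorial : ℚ) ≠ 0 := by positivity
    field_simp

end Multiplicity

/-! ### Quadratic dominant ideals -/

section Dominant

variable {K : Type*} [Field K] {n r : ℕ} {d o : Fin r → Fin n}

lemma IsStarFamily.quadric_injective (h : IsStarFamily d o) :
    Function.Injective (quadric d o) := by
  intro i j hij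
  by_contra hne
  refine h.not_sup_insert_le {j} i (by simpa using hne) ?_
  simp [hij]

lemma quadric_ne_zero_iff (i : Fin r) (x : Fin n) :
    quadric d o i x ≠ 0 ↔ d i = x ∨ o i = x := by
  rw [quadric_apply]
  split_ifs <;> simp_all

/-- A dominant variable other than its own edge's center divides only one generator. For any other
variable, the generators it divides are the edges centered there. So the shared variables are the
centers with several edges. -/
lemma IsStarFamily.numSharedVars_add (h : IsStarFamily d o) {G : Finset (Fin n →₀ ℕ)}
    (hG : (G : Set (Fin n →₀ ℕ)) = Set.range (quadric d o)) :
    numSharedVars G + (simpleCenters o).card = (Finset.univ.image o).card := by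
  classical
  have hG' : G = Finset.univ.image (quadric d o) := by
    rw [← Finset.coe_inj, hG]
    simp
  have hcard : ∀ x, (G.filter fun m => m x ≠ 0).card =
      (Finset.univ.filter fun i => d i = x ∨ o i = x).card := by
    intro x
    rw [hG', Finset.filter_image, Finset.card_image_of_injective _ h.quadric_injective]
    simp only [quadric_ne_zero_iff]
  have hiff : ∀ x, 1 < (G.filter fun m => m x ≠ 0).card ↔
      1 < (Finset.univ.filter fun i => o i = x).card := by
    intro x
    rw [hcard]
    by_cases hx : ∃ i, d i = x ∧ o i ≠ x
    · obtain ⟨i, rfl, hi⟩ := hx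
      have h1 : ∀ j, o j ≠ d i := fun j hj => hi (h.eq_of_eq i j hj.symm).symm
      simp only [h1, h.injective.eq_iff, or_false]
      simp [Finset.filter_eq']
    · push Not at hx
      have h1 : ∀ i, (d i = x ∨ o i = x) ↔ o i = x := fun i => or_iff_right_of_imp (hx i)
      simp only [h1]
  have hshared : (Finset.univ.filter fun x : Fin n => 1 < (G.filter fun m => m x ≠ 0).card) =
      (Finset.univ.image o).filter fun x =>
        ¬(Finset.univ.filter fun i => o i = x).card = 1 := by
    ext x
    rw [Finset.mem_filter, Finset.mem_filter, hiff]
    constructor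
    · rintro ⟨_, hx⟩
      obtain ⟨i, hi⟩ := Finset.card_pos.1 (zero_lt_one.trans hx)
      exact ⟨Finset.mem_image.2 ⟨i, Finset.mem_univ _, by simpa using hi⟩, by omega⟩
    · rintro ⟨hx, hx'⟩
      have := one_le_card_fiber hx
      exact ⟨Finset.mem_univ _, by omega⟩
  rw [numSharedVars, hshared, add_comm]
  exact Finset.card_filter_add_card_filter_not _

lemma exists_dominant_factorization {G : Finset (Fin n →₀ ℕ)} (hdeg : ∀ m ∈ G, m.degree = 2)
    (hdom : ∀ m ∈ G, IsDominantIn G m) {m : Fin n →₀ ℕ} (hm : m ∈ G) :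
    ∃ x y : Fin n, m = Finsupp.single x 1 + Finsupp.single y 1 ∧
      ∀ m' ∈ G, m' ≠ m → m' x < m x := by
  have hx : ∃ x, m x ≠ 0 ∧ ∀ m' ∈ G, m' ≠ m → m' x < m x := by
    obtain ⟨x, hx⟩ := hdom m hm
    -- Exponent zero is possible only if `m` is the sole generator; then any variable of `m` serves.
    by_cases h0 : m x = 0
    · have h1 : m ≠ 0 := by
        rintro rfl
        simpa using hdeg _ hm
      obtain ⟨y, hy⟩ := Finsupp.ne_iff.1 h1
      refine ⟨y, hy, fun m' hm' hne => ?_⟩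
      have := hx m' hm' hne
      omega
    · exact ⟨x, h0, hx⟩
  obtain ⟨x, hx0, hx⟩ := hx
  have hle : Finsupp.single x 1 ≤ m := by
    rw [Finsupp.single_le_iff]
    omega
  have h1 : (m - Finsupp.single x 1).degree = 1 := by
    have h2 := congrArg Finsupp.degree (tsub_add_cancel_of_le hle)
    rw [map_add, hdeg m hm, Finsupp.degree_single] at h2
    omega
  obtain ⟨y, hy⟩ : m - Finsupp.single x 1 ∈ Set.range fun y : Fin n => Finsupp.single y 1 := by
    rw [Finsupp.range_single_one]
    exact h1
  refine ⟨x, y, ?_, hx⟩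
  exact ((congrArg _ hy).trans (add_tsub_cancel_of_le hle)).symm

lemma exists_isStarFamily {G : Finset (Fin n →₀ ℕ)} (hdeg : ∀ m ∈ G, m.degree = 2)
    (hdom : ∀ m ∈ G, IsDominantIn G m) :
    ∃ (r : ℕ) (d o : Fin r → Fin n), IsStarFamily d o ∧
      (G : Set (Fin n →₀ ℕ)) = Set.range (quadric d o) := by
  choose x y hxy hdx using fun m : G => exists_dominant_factorization hdeg hdom m.2
  let q := G.equivFin.symm
  have hq : ∀ i, quadric (fun i => x (q i)) (fun i => y (q i)) i = (q i : Fin n →₀ ℕ) :=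
    fun i => (hxy (q i)).symm
  have hlt : ∀ i j, i ≠ j → (q j : Fin n →₀ ℕ) (x (q i)) < (q i : Fin n →₀ ℕ) (x (q i)) :=
    fun i j hij => hdx (q i) (q j) (q j).2 fun h' => hij (q.injective (Subtype.ext h'.symm))
  refine ⟨_, fun i => x (q i), fun i => y (q i), ⟨fun i j hij => ?_, fun i j hij => ?_⟩, ?_⟩
  · by_contra hne
    have h1 := hlt i j hne
    have h2 := hlt j i (Ne.symm hne)
    change x (q i) = x (q j) at hij
    rw [hij] at h1
    exact h1.asymm h2
  · by_contra hne
    have hij' : i ≠ j := by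
      rintro rfl
      exact hne hij
    -- Here `x_{d i}` has exponent 1 in the `i`-th generator, as `d i ≠ o i`, and at least 1 in the
    -- `j`-th, against dominance.
    have h1 := hlt i j hij'
    rw [← hq i, ← hq j, quadric_apply, quadric_apply, if_pos hij.symm, if_pos rfl,
      if_neg (Ne.symm hne)] at h1
    omega
  · ext m
    constructor
    · intro hm
      exact ⟨q.symm ⟨m, hm⟩, by rw [hq, Equiv.apply_symm_apply]⟩
    · rintro ⟨i, rfl⟩
      rw [hq]
      exact (q i).2

end Dominant

end

end DominantIdeals

theorem mainTheorem8 {K : Type*} [Field K] (n : ℕ) (M : Ideal (MvPolynomial (Fin n) K))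
    (G : Finset (Fin n →₀ ℕ)) (hM : DominantIdeals.IsQuadraticDominant M G)
    (k : ℕ) (hk : k = DominantIdeals.numSharedVars G) :
    -- the regularity and the codimension are finite, attained and equal
    IsGreatest {s : ℕ | ∃ i : ℕ, DominantIdeals.gradedBetti M i (i + s) ≠ 0}
      (DominantIdeals.regularity M) ∧
    DominantIdeals.codim M = (DominantIdeals.regularity M : ℕ∞) ∧
    -- the multiplicity as a power of two
    DominantIdeals.multiplicity M = (2 : ℚ) ^ ((DominantIdeals.regularity M : ℤ) - (k : ℤ)) ∧
    DominantIdeals.multiplicity M =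
      (2 : ℚ) ^ (((DominantIdeals.codim M).toNat : ℤ) - (k : ℤ)) ∧
    -- the equivalent logarithmic form
    (DominantIdeals.regularity M : ℝ) =
      (k : ℝ) + Real.logb 2 ((DominantIdeals.multiplicity M : ℚ) : ℝ) ∧
    ((DominantIdeals.codim M).toNat : ℝ) =
      (k : ℝ) + Real.logb 2 ((DominantIdeals.multiplicity M : ℚ) : ℝ) := by
  obtain ⟨r, d, o, h, hG⟩ := DominantIdeals.exists_isStarFamily hM.degree_eq_two hM.dominant
  have hspan := hM.isMinimalMonomialGenSet.span_eq
  rw [hG] at hspan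
  have hreg := h.regularity_eq hspan
  have hcodim := h.codim_eq hspan
  rw [← hreg] at hcodim
  have hsum := h.numSharedVars_add hG
  rw [← hk, ← hreg] at hsum
  have hmult := h.multiplicity_eq hspan
  have hpow : DominantIdeals.multiplicity M =
      (2 : ℚ) ^ ((DominantIdeals.regularity M : ℤ) - (k : ℤ)) := by
    rw [hmult, ← hsum, Nat.cast_add, add_sub_cancel_left, zpow_natCast]
  have hlog : (DominantIdeals.regularity M : ℝ) =
      (k : ℝ) + Real.logb 2 ((DominantIdeals.multiplicity M : ℚ) : ℝ) := by
    rw [hmult, ← hsum]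
    push_cast
    rw [Real.logb_pow, Real.logb_self_eq_one one_lt_two, mul_one]
  refine ⟨hreg ▸ h.isGreatest hspan, hcodim, hpow, ?_, hlog, ?_⟩
  · rw [hcodim, ENat.toNat_natCast]
    exact hpow
  · rw [hcodim, ENat.toNat_natCast]
    exact hlog
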